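/- A \emph{hexagonal system} $(\mathbb J,\mathbb F,\#)$ consists of a commutative field $\mathbb F$, an $\mathbb F$-vector space $\mathbb J$, a map $\#:\mathbb J\to\mathbb J$, a function $\mathsf N:\mathbb J\to\mathbb F$, a symmetric bilinear form $\mathsf T:\mathbb J\times\mathbb J\to\mathbb F$, a symmetric bilinear map $\times:\mathbb J\times\mathbb J\to\mathbb J$ and an element $1\in\mathbb J\setminus\{0\}$ such that for all $t\in\mathbb F$, $a,b,c\in\mathbb J$: $(ta)^\#=t^2a^\#$; $\mathsf N(ta)=t^3\mathsf N(a)$; $\mathsf T(a,b\times c)=\mathsf T(a\times b,c)$; $(a+b)^\#=a^\#+a\times b+b^\#$; $\mathsf N(a+b)=\mathsf N(a)+\mathsf T(a^\#,b)+\mathsf T(a,b^\#)+\mathsf N(b)$; $\mathsf T(a,a^\#)=3\mathsf N(a)$; $a^{\#\#}=\mathsf N(a)a$; $a^\#\times(a\times b)=\mathsf N(a)b+\mathsf T(a^\#,b)a$; $a^\#\times b^\#+(a\times b)^\#=\mathsf T(a^\#,b)b+\mathsf T(a,b^\#)a$; $1^\#=1$; $a=\mathsf T(a,1)1-1\times a$;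 and $\mathsf N(a)=0$ only if $a=0$. Write $\mathsf T(a)=\mathsf T(a,1)$, $a^{-1}=\mathsf N(a)^{-1}a^\#$ for $a\ne0$, and identify $t\in\mathbb F$ with $t1\in\mathbb J$. An automorphism of the system is an $\mathbb F$-linear bijection $h$ of $\mathbb J$, written $a\mapsto a^h$, with $(a^\#)^h=(a^h)^\#$ for all $a$. Let $\Gamma$ be the Moufang hexagon of $(\mathbb J,\mathbb F,\#)$, that is, the one with positive root groups $U_i=\{x_i(c)\}$, $1\le i\le 6$ ($c\in\mathbb J$ for $i$ odd, $c\in\mathbb F$ for $i$ even, each $x_i$ additive), whose nontrivial commutator relations are, with $[g,k]=g^{-1}k^{-1}gk$, $[x_1(a),x_3(b)]=x_2(\mathsf T(a,b))$, $[x_3(a),x_5(b)]=x_4(\mathsf T(a,b))$, $[x_1(a),x_5(b)]=x_2(-\mathsf T(a^\#,b))x_3(a\times b)x_4(\mathsf T(a,b^\#))$, $[x_2(t),x_6(u)]=x_4(tu)$, $[x_1(a),x_6(t)]=x_2(-t\mathsf N(a))x_3(ta^\#)x_4(t^2\mathsf N(a))x_5(-ta)$, where the points on a line are indexed by $\{\infty\}\cup\mathbb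 F$ and the lines through a point by $\{\infty\}\cup\mathbb J$. Explicitly, the points of $\Gamma$ are $(\infty)$, $(t)$, $(b,u)$, $(t,a,t')$, $(b,u,b',u')$, $(t,a,t',a',t'')$ and the lines are $[\infty]$, $[b]$, $[t,a]$, $[b,u,b']$, $[t,a,t',a']$, $[b,u,b',u',b'']$ with $t,t',t'',u,u'\in\mathbb F$ and $a,a',b,b',b''\in\mathbb J$; consecutive terms of $$(t,a,t',a',t''),[t,a,t',a'],(t,a,t'),[t,a],(t),[\infty],(\infty),[b],(b,u),[b,u,b'],(b,u,b',u'),[b,u,b',u',b'']$$ are incident, $(t,a,t',a',t'')$ is incident with $[b,u,b',u',b'']$ if and only if $a=b''-tb$, $t'=u'+t^2\mathsf N(b)+ut-t\mathsf T(b'',b^\#)+\mathsf T(b',b'')+\mathsf T(b''^\#,b)$, $a'=b'+b\times b''-tb^\#$ and $t''=u-t\mathsf N(b)+\mathsf T(b,b')+\mathsf T(b'',b^\#)$, and there are no other incidences. Here $(t,a,t',a',t'')$ stands for the coset of $x_6(t)x_5(a)x_4(t')x_3(a')x_2(t'')$, and $[b,u,b',u',b'']$ for that of $x_1(b)x_2(u)x_3(b')x_4(u')x_5(b'')$,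 and similarly for shorter tuples; $x_1(c)$ acts by left multiplication. Let $x_7(a)$ denote the elements of the root group opposite to $U_1$ with respect to the base apartment (the one formed by the elements with all coordinates $0$ or $\infty$), indexed so that $s_1=x_7(1)x_1(1)x_7(1)$ stabilises this apartment and $s_1x_1(a)s_1^{-1}=x_7(a)$. An automorphism $h$ of the hexagonal system is regarded as the collineation of $\Gamma$ that applies $h$ to every $\mathbb J$-coordinate. \textbf{Theorem.} Let $h:\mathbb J\to\mathbb J$ be an automorphism of the hexagonal system $(\mathbb J,\mathbb F,\#)$, of order $1$ or $3$, such that $$\mathsf T(a)=a+a^h+a^{h^2}\quad\text{and}\quad \mathsf T(a^\#)=\mathsf T(a,a^h)\qquad\text{for all }a\in\mathbb J.$$ Then the collineation $\theta=h\,x_1(1)\,s_1$ of $\Gamma$ (a product of maps acting from the left) is point-domestic: no point $p$ of $\Gamma$ is opposite $\theta(p)$, where two points are opposite if they are at distance $6$ in the incidence graph. -/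

import Mathlib

/-- A hexagonal system `(J, F, #)`: a vector space `J` over a commutative field `F` with an
adjoint `#`, together with the norm, the trace form, the symmetric bilinear product `×` and the
identity that belong to it. -/
structure HexagonalSystem (F J : Type*) [Field F] [AddCommGroup J] [Module F J] where
  /-- the adjoint `a ↦ a^#` -/
  sharp : J → J
  /-- the norm `N` -/
  norm : J → F
  /-- the trace form `T(a, b)` -/
  tr : J →ₗ[F] J →ₗ[F] F
  /-- the product `a × b` -/
  cross : J →ₗ[F] J →ₗ[F] J
  /-- the identity `1` -/
  one : J
  one_ne_zero : one ≠ 0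
  tr_comm : ∀ a b, tr a b = tr b a
  cross_comm : ∀ a b, cross a b = cross b a
  sharp_smul : ∀ (t : F) (a : J), sharp (t • a) = t ^ 2 • sharp a
  norm_smul : ∀ (t : F) (a : J), norm (t • a) = t ^ 3 * norm a
  tr_cross : ∀ a b c, tr a (cross b c) = tr (cross a b) c
  sharp_add : ∀ a b, sharp (a + b) = sharp a + cross a b + sharp b
  norm_add : ∀ a b, norm (a + b) = norm a + tr (sharp a) b + tr a (sharp b) + norm b
  tr_sharp : ∀ a, tr a (sharp a) = 3 * norm a
  sharp_sharp : ∀ a, sharp (sharp a) = norm a • a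
  sharp_cross_cross : ∀ a b,
    cross (sharp a) (cross a b) = norm a • b + tr (sharp a) b • a
  sharp_cross_sharp : ∀ a b,
    cross (sharp a) (sharp b) + sharp (cross a b) = tr (sharp a) b • b + tr a (sharp b) • a
  sharp_one : sharp one = one
  eq_tr_sub : ∀ a, a = tr a one • one - cross one a
  norm_eq_zero_iff : ∀ a, norm a = 0 ↔ a = 0

/-- The points of the hexagon, in coordinates: the point `(∞)` and the tuples
`(t)`, `(b, u)`, `(t, a, t')`, `(b, u, b', u')`, `(t, a, t', a', t'')`.  They stand for the cosets
`P₁`, `x₆(t)s₆P₁`, `x₁(b)x₂(u)s₁s₆P₁`, `x₆(t)x₅(a)x₄(t')s₆s₁s₆P₁`,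
`x₁(b)x₂(u)x₃(b')x₄(u')s₁s₆s₁s₆P₁`, `x₆(t)x₅(a)x₄(t')x₃(a')x₂(t'')s₆s₁s₆s₁s₆P₁`. -/
inductive HexPoint (F J : Type*) where
  | p0 : HexPoint F J
  | p1 (t : F) : HexPoint F J
  | p2 (b : J) (u : F) : HexPoint F J
  | p3 (t : F) (a : J) (t' : F) : HexPoint F J
  | p4 (b : J) (u : F) (b' : J) (u' : F) : HexPoint F J
  | p5 (t : F) (a : J) (t' : F) (a' : J) (t'' : F) : HexPoint F J

/-- The lines of the hexagon, in coordinates: the line `[∞]` and the tuples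
`[b]`, `[t, a]`, `[b, u, b']`, `[t, a, t', a']`, `[b, u, b', u', b'']`.  They stand for the cosets
`P₆`, `x₁(b)s₁P₆`, `x₆(t)x₅(a)s₆s₁P₆`, `x₁(b)x₂(u)x₃(b')s₁s₆s₁P₆`,
`x₆(t)x₅(a)x₄(t')x₃(a')s₆s₁s₆s₁P₆`, `x₁(b)x₂(u)x₃(b')x₄(u')x₅(b'')s₁s₆s₁s₆s₁P₆`. -/
inductive HexLine (F J : Type*) where
  | l0 : HexLine F J
  | l1 (b : J) : HexLine F J
  | l2 (t : F) (a : J) : HexLine F J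
  | l3 (b : J) (u : F) (b' : J) : HexLine F J
  | l4 (t : F) (a : J) (t' : F) (a' : J) : HexLine F J
  | l5 (b : J) (u : F) (b' : J) (u' : F) (b'' : J) : HexLine F J

namespace HexagonalSystem

open HexPoint HexLine

noncomputable section

variable {F J : Type*} [Field F] [AddCommGroup J] [Module F J] (S : HexagonalSystem F J)

/-- The trace `T(a) = T(a, 1)`. -/
def trace (a : J) : F := S.tr a S.one

/-- The inverse `a⁻¹ = N(a)⁻¹ a^#`. -/
def inv (a : J) : J := (S.norm a)⁻¹ • S.sharp a

/-- An automorphism of the hexagonal system: a vector space automorphism commuting with `#`. -/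
def IsAut (h : J ≃ₗ[F] J) : Prop := ∀ a, h (S.sharp a) = S.sharp (h a)

/-- Incidence in the Moufang hexagon of the hexagonal system. -/
def Inc : HexPoint F J → HexLine F J → Prop
  | p0, l0 => True
  | p0, l1 _ => True
  | p1 _, l0 => True
  | p1 t, l2 t₁ _ => t = t₁
  | p2 b _, l1 b₁ => b = b₁
  | p2 b u, l3 b₁ u₁ _ => b = b₁ ∧ u = u₁
  | p3 t a _, l2 t₁ a₁ => t = t₁ ∧ a = a₁
  | p3 t a t', l4 t₁ a₁ t₁' _ => t = t₁ ∧ a = a₁ ∧ t' = t₁'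
  | p4 b u b' _, l3 b₁ u₁ b₁' => b = b₁ ∧ u = u₁ ∧ b' = b₁'
  | p4 b u b' u', l5 b₁ u₁ b₁' u₁' _ => b = b₁ ∧ u = u₁ ∧ b' = b₁' ∧ u' = u₁'
  | p5 t a t' a' _, l4 t₁ a₁ t₁' a₁' => t = t₁ ∧ a = a₁ ∧ t' = t₁' ∧ a' = a₁'
  | p5 t a t' a' t'', l5 b u b' u' b'' =>
      a = b'' - t • b ∧
      t' = u' + t ^ 2 * S.norm b + u * t - t * S.tr b'' (S.sharp b) + S.tr b' b''
        + S.tr (S.sharp b'') b ∧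
      a' = b' + S.cross b b'' - t • S.sharp b ∧
      t'' = u - t * S.norm b + S.tr b b' + S.tr b'' (S.sharp b)
  | _, _ => False

/-- The incidence graph of the hexagon. -/
def incGraph : SimpleGraph (HexPoint F J ⊕ HexLine F J) :=
  SimpleGraph.fromRel fun x y => ∃ p l, x = Sum.inl p ∧ y = Sum.inr l ∧ S.Inc p l

/-- Two elements of the hexagon are opposite if they are at distance `6` in the incidence graph. -/
def Opposite (x y : HexPoint F J ⊕ HexLine F J) : Prop := S.incGraph.dist x y = 6

/-- The group `G` of all collineations of the hexagon: pairs of a permutation of the points and a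
permutation of the lines that preserve incidence and non-incidence. -/
def collineationGroup :
    Subgroup (Equiv.Perm (HexPoint F J) × Equiv.Perm (HexLine F J)) where
  carrier := {g | ∀ p l, S.Inc (g.1 p) (g.2 l) ↔ S.Inc p l}
  mul_mem' := by
    intro g k hg hk p l
    exact (hg _ _).trans (hk _ _)
  one_mem' := fun p l => Iff.rfl
  inv_mem' := by
    intro g hg p l
    have := hg (g.1⁻¹ p) (g.2⁻¹ l)
    simpa using this.symm

/-- A collineation is point-domestic if it maps no point to an opposite point. -/
def PointDomestic (g : S.collineationGroup) : Prop :=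
  ∀ p : HexPoint F J, ¬ S.Opposite (Sum.inl p) (Sum.inl (g.1.1 p))

/-! ### Elementary identities -/

lemma sharp_zero : S.sharp 0 = 0 := by
  have := S.sharp_smul 0 0
  simpa using this

lemma norm_zero : S.norm 0 = 0 := (S.norm_eq_zero_iff 0).2 rfl

lemma sharp_neg (a : J) : S.sharp (-a) = S.sharp a := by
  have := S.sharp_smul (-1) a
  simpa using this

lemma norm_neg (a : J) : S.norm (-a) = - S.norm a := by
  have := S.norm_smul (-1) a
  have h3 : ((-1 : F)) ^ 3 = -1 := by ring
  simpa [h3] using this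

lemma cross_self (a : J) : S.cross a a = (2 : F) • S.sharp a := by
  have h1 := S.sharp_add a a
  have h2 := S.sharp_smul 2 a
  rw [two_smul] at h2
  rw [h2] at h1
  have : S.cross a a = ((2 : F) ^ 2 • S.sharp a) - S.sharp a - S.sharp a := by
    rw [h1]; abel
  rw [this]; module

lemma norm_ne_zero {a : J} (ha : a ≠ 0) : S.norm a ≠ 0 := fun h =>
  ha ((S.norm_eq_zero_iff a).1 h)

lemma sharp_ne_zero {a : J} (ha : a ≠ 0) : S.sharp a ≠ 0 := by
  intro h
  have h1 := S.sharp_sharp a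
  rw [h, S.sharp_zero] at h1
  exact (smul_ne_zero (S.norm_ne_zero ha) ha) h1.symm

lemma norm_sharp {a : J} : S.norm (S.sharp a) = S.norm a ^ 2 := by
  by_cases ha : a = 0
  · subst ha; simp [S.sharp_zero, S.norm_zero]
  · have h1 := S.sharp_sharp (S.sharp a)
    rw [S.sharp_sharp a, S.sharp_smul] at h1
    exact (smul_left_injective F (S.sharp_ne_zero ha) h1).symm

lemma cross_cross_sharp (a b : J) :
    S.cross a (S.cross (S.sharp a) b) = S.norm a • b + S.tr a b • S.sharp a := by
  by_cases ha : a = 0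
  · subst ha; simp [S.norm_zero]
  · have h1 := S.sharp_cross_cross (S.sharp a) b
    rw [S.sharp_sharp, S.norm_sharp] at h1
    simp only [map_smul, LinearMap.smul_apply] at h1
    have h2 : S.norm a • S.cross a (S.cross (S.sharp a) b)
        = S.norm a • (S.norm a • b + S.tr a b • S.sharp a) := by
      rw [h1]; simp only [smul_eq_mul]; module
    exact smul_right_injective J (S.norm_ne_zero ha) h2

lemma isAut_norm {h : J ≃ₗ[F] J} (hh : S.IsAut h) (a : J) : S.norm (h a) = S.norm a := by
  by_cases ha : a = 0
  · subst ha; simp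
  · have h1 := S.sharp_sharp (h a)
    rw [← hh, ← hh, S.sharp_sharp, map_smul] at h1
    exact (smul_left_injective F (by simpa using ha : h a ≠ 0) h1).symm

lemma isAut_cross {h : J ≃ₗ[F] J} (hh : S.IsAut h) (a b : J) :
    S.cross (h a) (h b) = h (S.cross a b) := by
  have h1 := S.sharp_add (h a) (h b)
  rw [← map_add, ← hh, S.sharp_add, ← hh, ← hh, map_add, map_add] at h1
  exact (add_left_cancel (add_right_cancel h1)).symm

lemma isAut_tr {h : J ≃ₗ[F] J} (hh : S.IsAut h) (a b : J) :
    S.tr (h a) (h b) = S.tr a b := by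
  by_cases ha : a = 0
  · subst ha; simp
  · have key : ∀ c : J, c ≠ 0 → S.tr (h (S.sharp c)) (h b) = S.tr (S.sharp c) b := by
      intro c hc
      have h1 := S.sharp_cross_cross (h c) (h b)
      rw [← hh, S.isAut_cross hh, S.isAut_cross hh, S.sharp_cross_cross, S.isAut_norm hh,
        map_add, map_smul, map_smul] at h1
      exact (smul_left_injective F (by simpa using hc : h c ≠ 0) (add_left_cancel h1)).symm
    have h2 := key (S.sharp a) (S.sharp_ne_zero ha)
    rw [S.sharp_sharp] at h2
    simp only [map_smul, LinearMap.smul_apply, smul_eq_mul] at h2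
    exact mul_left_cancel₀ (S.norm_ne_zero ha) h2

/-! ### The collineation induced by an automorphism of the hexagonal system -/

/-- Apply `h` to the `J`-coordinates of a point. -/
def autPoint (h : J ≃ₗ[F] J) : HexPoint F J → HexPoint F J
  | p0 => p0
  | p1 t => p1 t
  | p2 b u => p2 (h b) u
  | p3 t a t' => p3 t (h a) t'
  | p4 b u b' u' => p4 (h b) u (h b') u'
  | p5 t a t' a' t'' => p5 t (h a) t' (h a') t''

/-- Apply `h` to the `J`-coordinates of a line. -/
def autLine (h : J ≃ₗ[F] J) : HexLine F J → HexLine F J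
  | l0 => l0
  | l1 b => l1 (h b)
  | l2 t a => l2 t (h a)
  | l3 b u b' => l3 (h b) u (h b')
  | l4 t a t' a' => l4 t (h a) t' (h a')
  | l5 b u b' u' b'' => l5 (h b) u (h b') u' (h b'')

/-- An automorphism `h` of the hexagonal system, regarded as a collineation: it acts
coordinatewise, that is, `h xᵢ(c) h⁻¹ = xᵢ(c^h)` and `h` fixes the base apartment. -/
def ofAut (h : J ≃ₗ[F] J) (hh : S.IsAut h) : S.collineationGroup :=
  ⟨(⟨autPoint h, autPoint h.symm, by rintro (_ | _) <;> simp [autPoint],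
      by rintro (_ | _) <;> simp [autPoint]⟩,
    ⟨autLine h, autLine h.symm, by rintro (_ | _) <;> simp [autLine],
      by rintro (_ | _) <;> simp [autLine]⟩), by
    intro p l
    have e1 : ∀ (x y z : J) (t : F), h x = h y - t • h z ↔ x = y - t • z := fun x y z t => by
      rw [← map_smul, ← map_sub, h.injective.eq_iff]
    have e2 : ∀ (x y z w : J) (t : F), h x = h y + h z - t • h w ↔ x = y + z - t • w :=
      fun x y z w t => by
        rw [← map_smul, ← map_add, ← map_sub, h.injective.eq_iff]
    cases p <;> cases l <;>
      simp [autPoint, autLine, Inc, ← hh _, S.isAut_norm hh, S.isAut_tr hh, S.isAut_cross hh,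
        e1, e2]⟩

/-! ### The root elations `x₁(c)` -/

/-- The action of `x₁(c)` on points, by left multiplication on the cosets. -/
def x₁Point (c : J) : HexPoint F J → HexPoint F J
  | p0 => p0
  | p1 t => p1 t
  | p2 b u => p2 (b + c) u
  | p3 t a t' => p3 t (a - t • c)
      (t' + t ^ 2 * S.norm c - t * S.tr (S.sharp c) a + S.tr c (S.sharp a))
  | p4 b u b' u' => p4 (b + c) u b' u'
  | p5 t a t' a' t'' => p5 t (a - t • c)
      (t' + t ^ 2 * S.norm c - t * S.tr (S.sharp c) a + S.tr c (S.sharp a))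
      (a' + S.cross c a - t • S.sharp c)
      (t'' - t * S.norm c + S.tr (S.sharp c) a + S.tr c a')

/-- The action of `x₁(c)` on lines, by left multiplication on the cosets. -/
def x₁Line (c : J) : HexLine F J → HexLine F J
  | l0 => l0
  | l1 b => l1 (b + c)
  | l2 t a => l2 t (a - t • c)
  | l3 b u b' => l3 (b + c) u b'
  | l4 t a t' a' => l4 t (a - t • c)
      (t' + t ^ 2 * S.norm c - t * S.tr (S.sharp c) a + S.tr c (S.sharp a))
      (a' + S.cross c a - t • S.sharp c)
  | l5 b u b' u' b'' => l5 (b + c) u b' u' b''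

lemma tr_sharp' (a : J) : S.tr (S.sharp a) a = 3 * S.norm a := by
  rw [S.tr_comm, S.tr_sharp]

lemma sharp_sub (a b : J) : S.sharp (a - b) = S.sharp a - S.cross a b + S.sharp b := by
  rw [sub_eq_add_neg, S.sharp_add, S.sharp_neg, map_neg, ← sub_eq_add_neg]

lemma tr_cross_self (a b : J) : S.tr a (S.cross a b) = 2 * S.tr (S.sharp a) b := by
  rw [S.tr_cross, S.cross_self]; simp

lemma tr_cross_self' (a b : J) : S.tr a (S.cross b a) = 2 * S.tr (S.sharp a) b := by
  rw [S.cross_comm, S.tr_cross_self]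

lemma x₁Point_neg (c : J) (p : HexPoint F J) : S.x₁Point (-c) (S.x₁Point c p) = p := by
  cases p <;>
    simp only [x₁Point, S.norm_neg, S.sharp_neg, add_neg_cancel_right, smul_neg, sub_neg_eq_add,
      sub_add_cancel, S.sharp_sub, S.sharp_smul, map_smul, map_neg, map_sub, map_add,
      LinearMap.neg_apply, smul_eq_mul, S.tr_sharp', S.tr_sharp, S.tr_cross_self,
      S.tr_cross_self', S.cross_self, HexPoint.p3.injEq, HexPoint.p5.injEq, true_and]
  · ring
  · refine ⟨by ring, by module, by ring⟩

lemma x₁Line_neg (c : J) (l : HexLine F J) : S.x₁Line (-c) (S.x₁Line c l) = l := by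
  cases l <;>
    simp only [x₁Line, S.norm_neg, S.sharp_neg, add_neg_cancel_right, smul_neg, sub_neg_eq_add,
      sub_add_cancel, S.sharp_sub, S.sharp_smul, map_smul, map_neg, map_sub, map_add,
      LinearMap.neg_apply, smul_eq_mul, S.tr_sharp', S.tr_sharp, S.tr_cross_self,
      S.tr_cross_self', S.cross_self, HexLine.l4.injEq, true_and]
  · refine ⟨by ring, by module⟩

lemma x₁_inc (c : J) {p : HexPoint F J} {l : HexLine F J} (h : S.Inc p l) :
    S.Inc (S.x₁Point c p) (S.x₁Line c l) := by
  cases p <;> cases l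
  case p5.l5 t a t' a' t'' b u b' u' b'' =>
    obtain ⟨rfl, rfl, rfl, rfl⟩ := h
    have e1 : S.tr b (S.cross c b'') = S.tr b'' (S.cross b c) := by
      rw [S.tr_cross, S.tr_comm]
    have e2 : S.tr c (S.cross b b'') = S.tr b'' (S.cross b c) := by
      rw [S.tr_cross, S.tr_comm, S.cross_comm]
    have e3 : S.tr c (S.cross b'' b) = S.tr b'' (S.cross b c) := by
      rw [S.cross_comm, e2]
    have e4 := S.tr_comm c b'
    have e5 := S.tr_comm (S.sharp c) b''
    have e6 := S.tr_comm (S.sharp c) b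
    have e7 := S.tr_comm c (S.sharp b)
    have e8 := S.tr_comm c (S.sharp b'')
    have e9 := S.cross_comm c b
    have e10 := S.tr_comm b c
    have e11 := S.tr_comm b b'
    simp only [Inc, x₁Point, x₁Line, S.norm_add, S.sharp_add, S.sharp_sub, S.sharp_smul, map_smul,
      map_sub, map_add, LinearMap.add_apply, smul_eq_mul, e1, e2, e3, e4, e5, e6, e7, e8, e9, e11]
    refine ⟨by module, by ring, by module, by ring⟩
  all_goals
    simp only [Inc, x₁Point, x₁Line] at h ⊢
    try grind

/-- The root elation `x₁(c)`. -/
def x₁ (c : J) : S.collineationGroup :=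
  ⟨(⟨S.x₁Point c, S.x₁Point (-c), S.x₁Point_neg c, fun p => by
        simpa using S.x₁Point_neg (-c) p⟩,
    ⟨S.x₁Line c, S.x₁Line (-c), S.x₁Line_neg c, fun l => by
        simpa using S.x₁Line_neg (-c) l⟩), fun p l =>
    ⟨fun h => by
      have := S.x₁_inc (-c) (p := S.x₁Point c p) (l := S.x₁Line c l) h
      rwa [S.x₁Point_neg, S.x₁Line_neg] at this, S.x₁_inc c⟩⟩

/-! ### The group `U₊` and the commutator relations

The hexagon of `(J, F, #)` is by definition the one whose positive root groups `U₁, …, U₆` satisfy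
the commutator relations below.  They present the group `U₊` with the normal form
`x₆(t) x₅(a) x₄(t') x₃(a') x₂(t'') x₁(c)`, and the point `(t, a, t', a', t'')` is incident with the
line `[b, u, b', u', b'']` exactly when the corresponding cosets of `U₁` and `U₆` intersect. -/

/-- The element `x₆(t) x₅(a) x₄(t') x₃(a') x₂(t'') x₁(c)` of `U₊`. -/
@[ext]
structure UPlus {F J : Type*} [Field F] [AddCommGroup J] [Module F J]
    (S : HexagonalSystem F J) where
  t : F
  a : J
  t' : F
  a' : J
  t'' : F
  c : J

namespace UPlus

variable {S}

instance : Mul (UPlus S) where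
  mul g k :=
    { t := g.t + k.t
      a := g.a + (k.a - k.t • g.c)
      t' := g.t' + (k.t' + k.t ^ 2 * S.norm g.c - k.t * S.tr (S.sharp g.c) k.a
        + S.tr g.c (S.sharp k.a)) + g.t'' * k.t + S.tr g.a' (k.a - k.t • g.c)
      a' := g.a' + (k.a' + S.cross g.c k.a - k.t • S.sharp g.c)
      t'' := g.t'' + (k.t'' - k.t * S.norm g.c + S.tr (S.sharp g.c) k.a + S.tr g.c k.a')
      c := g.c + k.c }

instance : One (UPlus S) where
  one := ⟨0, 0, 0, 0, 0, 0⟩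

instance : Inv (UPlus S) where
  inv g :=
    { t := -g.t
      a := -g.a - g.t • g.c
      t' := -g.t' + g.t * g.t'' + S.tr g.a' g.a - g.t ^ 2 * S.norm g.c
        - g.t * S.tr (S.sharp g.c) g.a - S.tr g.c (S.sharp g.a)
      a' := -g.a' + S.cross g.c g.a + g.t • S.sharp g.c
      t'' := -g.t'' - g.t * S.norm g.c - S.tr (S.sharp g.c) g.a + S.tr g.c g.a'
      c := -g.c }

lemma mul_def (g k : UPlus S) : g * k =
    { t := g.t + k.t
      a := g.a + (k.a - k.t • g.c)
      t' := g.t' + (k.t' + k.t ^ 2 * S.norm g.c - k.t * S.tr (S.sharp g.c) k.a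
        + S.tr g.c (S.sharp k.a)) + g.t'' * k.t + S.tr g.a' (k.a - k.t • g.c)
      a' := g.a' + (k.a' + S.cross g.c k.a - k.t • S.sharp g.c)
      t'' := g.t'' + (k.t'' - k.t * S.norm g.c + S.tr (S.sharp g.c) k.a + S.tr g.c k.a')
      c := g.c + k.c } := rfl

instance : Group (UPlus S) :=
  Group.ofLeftAxioms
    (by
      rintro ⟨t, a, t', a', t'', c⟩ ⟨s, d, s', d', s'', e⟩ ⟨r, f, r', f', r'', k⟩
      have q1 : S.tr c (S.cross d f) = S.tr (S.cross c d) f := S.tr_cross c d f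
      have q2 : S.tr c (S.cross e f) = S.tr (S.cross c e) f := S.tr_cross c e f
      have q3 : S.tr c (S.cross d e) = S.tr (S.cross c d) e := S.tr_cross c d e
      have q4 : S.tr (S.cross c e) d = S.tr (S.cross c d) e := by
        rw [← S.tr_cross, S.cross_comm e d, S.tr_cross]
      have q5 : S.tr (S.cross c f) e = S.tr (S.cross c e) f := by
        rw [← S.tr_cross, S.cross_comm f e, S.tr_cross]
      have q6 : S.tr (S.cross c e) e = 2 * S.tr c (S.sharp e) := by
        rw [← S.tr_cross, S.cross_self]; simp
      have q7 : S.tr (S.cross c e) c = 2 * S.tr (S.sharp c) e := by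
        rw [S.tr_comm, S.tr_cross_self]
      have q8 : S.tr (S.cross c d) c = 2 * S.tr (S.sharp c) d := by
        rw [S.tr_comm, S.tr_cross_self]
      have q9 : S.tr (S.cross c f) c = 2 * S.tr (S.sharp c) f := by
        rw [S.tr_comm, S.tr_cross_self]
      have q10 := S.tr_comm (S.sharp e) c
      have q11 := S.tr_comm d' c
      ext <;> simp only [mul_def, S.sharp_sub, S.sharp_add, S.sharp_smul, S.norm_add, map_sub,
        map_add, map_smul, LinearMap.sub_apply, LinearMap.add_apply, LinearMap.smul_apply,
        smul_eq_mul, S.cross_self, S.tr_sharp, S.tr_sharp', q1, q2, q3, q4, q5, q6, q7, q8, q9,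
        q10, q11, S.cross_comm f c, S.cross_comm f e, S.cross_comm d c, S.cross_comm e c]
      · ring
      · module
      · ring
      · module
      · ring
      · module)
    (by
      rintro ⟨t, a, t', a', t'', c⟩
      change (⟨0, 0, 0, 0, 0, 0⟩ : UPlus S) * _ = _
      ext <;> simp [mul_def, S.sharp_zero, S.norm_zero])
    (by
      rintro ⟨t, a, t', a', t'', c⟩
      change (⟨_, _, _, _, _, _⟩ : UPlus S) * _ = ⟨0, 0, 0, 0, 0, 0⟩
      have q1 : S.tr (S.cross c a) a = 2 * S.tr c (S.sharp a) := by
        rw [← S.tr_cross, S.cross_self]; simp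
      have q2 : S.tr (S.cross c a) c = 2 * S.tr (S.sharp c) a := by
        rw [S.tr_comm, S.tr_cross_self]
      ext <;> simp only [mul_def, S.sharp_neg, S.norm_neg, map_sub, map_add, map_smul, map_neg,
        LinearMap.sub_apply, LinearMap.add_apply, LinearMap.smul_apply, LinearMap.neg_apply,
        smul_eq_mul, S.tr_sharp', q1, q2, S.tr_comm a' c, smul_neg]
      · ring
      · module
      · ring
      · module
      · ring
      · module)

variable (S)

/-- `x₁(c)` in `U₊` -/
def y₁ (c : J) : UPlus S := ⟨0, 0, 0, 0, 0, c⟩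
/-- `x₂(t)` in `U₊` -/
def y₂ (t : F) : UPlus S := ⟨0, 0, 0, 0, t, 0⟩
/-- `x₃(a)` in `U₊` -/
def y₃ (a : J) : UPlus S := ⟨0, 0, 0, a, 0, 0⟩
/-- `x₄(t)` in `U₊` -/
def y₄ (t : F) : UPlus S := ⟨0, 0, t, 0, 0, 0⟩
/-- `x₅(a)` in `U₊` -/
def y₅ (a : J) : UPlus S := ⟨0, a, 0, 0, 0, 0⟩
/-- `x₆(t)` in `U₊` -/
def y₆ (t : F) : UPlus S := ⟨t, 0, 0, 0, 0, 0⟩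

lemma normal_form (t : F) (a : J) (t' : F) (a' : J) (t'' : F) (c : J) :
    y₆ S t * y₅ S a * y₄ S t' * y₃ S a' * y₂ S t'' * y₁ S c = ⟨t, a, t', a', t'', c⟩ := by
  ext <;> simp [mul_def, y₁, y₂, y₃, y₄, y₅, y₆, S.sharp_zero, S.norm_zero]

lemma comm_of_mul_eq {G : Type*} [Group G] {g k m : G} (h : g * k = k * g * m) :
    g⁻¹ * k⁻¹ * g * k = m := by
  rw [mul_assoc, h]; group

/-- The nontrivial commutator relations, where `[g, k] = g⁻¹ k⁻¹ g k`. -/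
lemma comm_rel (a b : J) (t u : F) :
    (y₁ S a)⁻¹ * (y₃ S b)⁻¹ * y₁ S a * y₃ S b = y₂ S (S.tr a b) ∧
    (y₃ S a)⁻¹ * (y₅ S b)⁻¹ * y₃ S a * y₅ S b = y₄ S (S.tr a b) ∧
    (y₁ S a)⁻¹ * (y₅ S b)⁻¹ * y₁ S a * y₅ S b =
      y₂ S (-S.tr (S.sharp a) b) * y₃ S (S.cross a b) * y₄ S (S.tr a (S.sharp b)) ∧
    (y₂ S t)⁻¹ * (y₆ S u)⁻¹ * y₂ S t * y₆ S u = y₄ S (t * u) ∧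
    (y₁ S a)⁻¹ * (y₆ S t)⁻¹ * y₁ S a * y₆ S t =
      y₂ S (-(t * S.norm a)) * y₃ S (t • S.sharp a) * y₄ S (t ^ 2 * S.norm a)
        * y₅ S (-(t • a)) := by
  refine ⟨comm_of_mul_eq ?_, comm_of_mul_eq ?_, comm_of_mul_eq ?_, comm_of_mul_eq ?_,
    comm_of_mul_eq ?_⟩ <;> ext <;>
    simp [mul_def, y₁, y₂, y₃, y₄, y₅, y₆, S.sharp_zero, S.norm_zero, S.sharp_neg,
      S.sharp_smul, S.tr_cross_self, S.tr_sharp, S.tr_sharp', S.cross_self] <;>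
    first | ring1 | module

lemma inc_iff_cosets_meet (t : F) (a : J) (t' : F) (a' : J) (t'' : F)
    (b : J) (u : F) (b' : J) (u' : F) (b'' : J) :
    S.Inc (p5 t a t' a' t'') (l5 b u b' u' b'') ↔
      ∃ (c : J) (s : F),
        y₆ S t * y₅ S a * y₄ S t' * y₃ S a' * y₂ S t'' * y₁ S c =
          y₁ S b * y₂ S u * y₃ S b' * y₄ S u' * y₅ S b'' * y₆ S s := by
  have q : S.tr (S.cross b b'') b = 2 * S.tr b'' (S.sharp b) := by
    rw [S.tr_comm, S.tr_cross_self, S.tr_comm]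
  have key : ∀ s : F, y₁ S b * y₂ S u * y₃ S b' * y₄ S u' * y₅ S b'' * y₆ S s =
      ⟨s, b'' - s • b,
        u' + s ^ 2 * S.norm b + u * s - s * S.tr b'' (S.sharp b) + S.tr b' b''
          + S.tr (S.sharp b'') b,
        b' + S.cross b b'' - s • S.sharp b,
        u - s * S.norm b + S.tr b b' + S.tr b'' (S.sharp b), b⟩ := by
    intro s
    ext <;> simp [mul_def, y₁, y₂, y₃, y₄, y₅, y₆, S.sharp_zero, S.tr_comm (S.sharp b) b'',
      S.tr_comm b (S.sharp b''), q, S.tr_comm b' b]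
    all_goals first | ring1 | module
  simp only [normal_form, key, UPlus.mk.injEq, Inc]
  constructor
  · rintro ⟨h1, h2, h3, h4⟩
    exact ⟨b, t, rfl, h1, h2, h3, h4, rfl⟩
  · rintro ⟨c, s, rfl, h1, h2, h3, h4, _⟩
    exact ⟨h1, h2, h3, h4⟩

/-- `x₁(c)` acts on the points `(t, a, t', a', t'')` by left multiplication. -/
lemma x₁Point_eq_mul (c : J) (g : UPlus S) :
    S.x₁Point c (p5 g.t g.a g.t' g.a' g.t'') =
      p5 (y₁ S c * g).t (y₁ S c * g).a (y₁ S c * g).t' (y₁ S c * g).a' (y₁ S c * g).t'' := by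
  simp [mul_def, y₁, x₁Point]

end UPlus

/-! ### The reflection `w` of the base apartment -/

open Classical in
/-- The action on points of the collineation `w` that fixes `(∞)`, interchanges `[∞]` and `[0]`,
stabilises the base apartment, and for which
`w x₁(c) w⁻¹ = x₇(c)`, `w x₂(t) w⁻¹ = x₆(t)`, `w x₃(c) w⁻¹ = x₅(c)`, `w x₄(t) w⁻¹ = x₄(t)`,
`w x₅(c) w⁻¹ = x₃(-c)`, `w x₆(t) w⁻¹ = x₂(-t)`. -/
def wPoint : HexPoint F J → HexPoint F J
  | p0 => p0
  | p1 t => p2 0 (-t)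
  | p2 b u => if b = 0 then p1 u else p2 (-S.inv b) (-((S.norm b)⁻¹ * u))
  | p3 t a t' => p4 0 (-t) (-a) t'
  | p4 b u b' u' => if b = 0 then p3 u b' u' else
      p4 (-S.inv b) (-((S.norm b)⁻¹ * u))
        (S.cross (S.inv b) b' - ((S.norm b)⁻¹ * (u + S.tr b b')) • b)
        (u' - (S.norm b)⁻¹ * u * (u + S.tr b b') - S.tr (S.inv b) (S.sharp b'))
  | p5 t a t' a' t'' => p5 t'' a' (t' - t * t'' - S.tr a a') (-a) (-t)

open Classical in
/-- The action of `w` on lines. -/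
def wLine : HexLine F J → HexLine F J
  | l0 => l1 0
  | l1 b => if b = 0 then l0 else l1 (-S.inv b)
  | l2 t a => l3 0 (-t) (-a)
  | l3 b u b' => if b = 0 then l2 u b' else
      l3 (-S.inv b) (-((S.norm b)⁻¹ * u))
        (S.cross (S.inv b) b' - ((S.norm b)⁻¹ * (u + S.tr b b')) • b)
  | l4 t a t' a' => l5 0 (-t) (-a) t' a'
  | l5 b u b' u' b'' => if b = 0 then l4 u b' u' (-b'') else
      l5 (-S.inv b) (-((S.norm b)⁻¹ * u))
        (S.cross (S.inv b) b' - ((S.norm b)⁻¹ * (u + S.tr b b')) • b)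
        (u' - (S.norm b)⁻¹ * u * (u + S.tr b b') - S.tr (S.inv b) (S.sharp b'))
        (b' + S.cross b b'' - (u + S.tr b b' + S.tr b'' (S.sharp b)) • S.inv b)

lemma inv_ne_zero {b : J} (hb : b ≠ 0) : S.inv b ≠ 0 :=
  smul_ne_zero (_root_.inv_ne_zero (S.norm_ne_zero hb)) (S.sharp_ne_zero hb)

lemma norm_inv {b : J} : S.norm (S.inv b) = (S.norm b)⁻¹ := by
  by_cases hb : b = 0
  · subst hb; simp [inv, S.norm_zero]
  · have := S.norm_ne_zero hb
    rw [inv, S.norm_smul, S.norm_sharp]; field_simp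

lemma sharp_inv {b : J} (hb : b ≠ 0) : S.sharp (S.inv b) = (S.norm b)⁻¹ • b := by
  have := S.norm_ne_zero hb
  rw [inv, S.sharp_smul, S.sharp_sharp, smul_smul]; congr 1; field_simp

lemma inv_neg (b : J) : S.inv (-b) = -S.inv b := by
  rw [inv, inv, S.norm_neg, S.sharp_neg, _root_.inv_neg, neg_smul]

lemma inv_inv {b : J} (hb : b ≠ 0) : S.inv (S.inv b) = b := by
  have := S.norm_ne_zero hb
  rw [inv, S.norm_inv, S.sharp_inv hb, smul_smul]; simp [this]

lemma tr_inv_self {b : J} (hb : b ≠ 0) : S.tr (S.inv b) b = 3 := by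
  have := S.norm_ne_zero hb
  rw [inv]; simp only [map_smul, LinearMap.smul_apply, S.tr_sharp', smul_eq_mul]; field_simp

lemma sharp_eq {b : J} (hb : b ≠ 0) : S.sharp b = S.norm b • S.inv b := by
  have := S.norm_ne_zero hb
  rw [inv, smul_smul]; simp [this]

lemma inv_cross_cross {b : J} (hb : b ≠ 0) (c : J) :
    S.cross (S.inv b) (S.cross b c) = c + S.tr (S.inv b) c • b := by
  have := S.norm_ne_zero hb
  rw [inv]; simp only [map_smul, LinearMap.smul_apply, S.sharp_cross_cross, smul_add, smul_smul]
  simp [this]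

lemma cross_inv_cross {b : J} (hb : b ≠ 0) (c : J) :
    S.cross b (S.cross (S.inv b) c) = c + S.tr b c • S.inv b := by
  have := S.inv_cross_cross (S.inv_ne_zero hb) c
  rwa [S.inv_inv hb] at this

lemma tr_inv_cross_inv {b : J} (hb : b ≠ 0) (c : J) :
    S.tr (S.inv b) (S.cross (S.inv b) c) = 2 * ((S.norm b)⁻¹ * S.tr b c) := by
  rw [S.tr_cross_self, S.sharp_inv hb]; simp

lemma tr_sharp_cross (b c : J) :
    S.tr (S.sharp b) (S.sharp (S.cross b c))
      = S.tr (S.sharp b) c ^ 2 + S.norm b * S.tr b (S.sharp c) := by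
  have h1 : S.sharp (S.cross b c)
      = S.tr (S.sharp b) c • c + S.tr b (S.sharp c) • b - S.cross (S.sharp b) (S.sharp c) := by
    rw [← S.sharp_cross_sharp]; abel
  rw [h1]
  simp only [map_add, map_sub, map_smul, smul_eq_mul, S.tr_cross_self, S.sharp_sharp,
    LinearMap.smul_apply, S.tr_sharp']
  ring

lemma tr_inv_sharp_cross {b : J} (hb : b ≠ 0) (c : J) :
    S.tr (S.inv b) (S.sharp (S.cross b c))
      = S.norm b * S.tr (S.inv b) c ^ 2 + S.tr b (S.sharp c) := by
  have hn := S.norm_ne_zero hb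
  have h := S.tr_sharp_cross b c
  rw [S.sharp_eq hb] at h
  simp only [map_smul, LinearMap.smul_apply, smul_eq_mul] at h
  apply mul_left_cancel₀ hn
  rw [h]; ring

lemma tr_sharp_inv_cross {b : J} (hb : b ≠ 0) (c : J) :
    S.tr b (S.sharp (S.cross (S.inv b) c))
      = (S.norm b)⁻¹ * S.tr b c ^ 2 + S.tr (S.inv b) (S.sharp c) := by
  have := S.tr_inv_sharp_cross (S.inv_ne_zero hb) c
  rwa [S.inv_inv hb, S.norm_inv] at this

/-- The square of `w` on points. -/
def w2Point : HexPoint F J → HexPoint F J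
  | p0 => p0
  | p1 t => p1 (-t)
  | p2 b u => p2 b (-u)
  | p3 t a t' => p3 (-t) (-a) t'
  | p4 b u b' u' => p4 b (-u) (-b') u'
  | p5 t a t' a' t'' => p5 (-t) (-a) t' (-a') (-t'')

/-- The square of `w` on lines. -/
def w2Line : HexLine F J → HexLine F J
  | l0 => l0
  | l1 b => l1 b
  | l2 t a => l2 (-t) (-a)
  | l3 b u b' => l3 b (-u) (-b')
  | l4 t a t' a' => l4 (-t) (-a) t' (-a')
  | l5 b u b' u' b'' => l5 b (-u) (-b') u' (-b'')

lemma w_aux2 {b : J} (hb : b ≠ 0) (u : F) :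
    -((S.norm (-S.inv b))⁻¹ * -((S.norm b)⁻¹ * u)) = -u := by
  have := S.norm_ne_zero hb
  rw [S.norm_neg, S.norm_inv]; field_simp

lemma w_aux_tr {b : J} (hb : b ≠ 0) (u : F) (b' : J) :
    S.tr (S.inv b) (S.cross (S.inv b) b' - ((S.norm b)⁻¹ * (u + S.tr b b')) • b)
      = -((S.norm b)⁻¹ * (3 * u + S.tr b b')) := by
  simp only [map_sub, map_smul, S.tr_inv_cross_inv hb, S.tr_inv_self hb, smul_eq_mul]
  ring

lemma w_aux3 {b : J} (hb : b ≠ 0) (u : F) (b' : J) :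
    S.cross (S.inv (-S.inv b)) (S.cross (S.inv b) b' - ((S.norm b)⁻¹ * (u + S.tr b b')) • b)
      - ((S.norm (-S.inv b))⁻¹ * (-((S.norm b)⁻¹ * u) + S.tr (-S.inv b)
        (S.cross (S.inv b) b' - ((S.norm b)⁻¹ * (u + S.tr b b')) • b))) • (-S.inv b) = -b' := by
  have hn := S.norm_ne_zero hb
  rw [map_neg S.tr, LinearMap.neg_apply, S.w_aux_tr hb, S.norm_neg, S.norm_inv, S.inv_neg,
    S.inv_inv hb]
  simp only [map_sub, map_neg, map_smul, LinearMap.neg_apply, S.cross_inv_cross hb, S.cross_self,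
    S.sharp_eq hb, smul_smul]
  match_scalars <;> field_simp <;> ring

lemma w_aux4 {b : J} (hb : b ≠ 0) (u : F) (b' : J) (u' : F) :
    (u' - (S.norm b)⁻¹ * u * (u + S.tr b b') - S.tr (S.inv b) (S.sharp b'))
      - (S.norm (-S.inv b))⁻¹ * (-((S.norm b)⁻¹ * u)) * (-((S.norm b)⁻¹ * u) + S.tr (-S.inv b)
        (S.cross (S.inv b) b' - ((S.norm b)⁻¹ * (u + S.tr b b')) • b))
      - S.tr (S.inv (-S.inv b)) (S.sharp
        (S.cross (S.inv b) b' - ((S.norm b)⁻¹ * (u + S.tr b b')) • b)) = u' := by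
  have hn := S.norm_ne_zero hb
  rw [map_neg S.tr (S.inv b), LinearMap.neg_apply, S.w_aux_tr hb, S.norm_neg, S.norm_inv, S.inv_neg,
    S.inv_inv hb]
  have e : S.tr b (S.cross (S.cross (S.inv b) b') b) = 4 * S.tr b b' := by
    rw [S.cross_comm, S.cross_inv_cross hb]
    simp only [map_add, map_smul, smul_eq_mul, S.tr_comm b (S.inv b), S.tr_inv_self hb]
    ring
  simp only [S.sharp_sub, S.sharp_smul, map_sub, map_add, map_neg, map_smul, LinearMap.neg_apply,
    S.tr_sharp_inv_cross hb, S.tr_sharp, e, smul_eq_mul]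
  field_simp
  ring

lemma w_aux5 {b : J} (hb : b ≠ 0) (u : F) (b' b'' : J) :
    (S.cross (S.inv b) b' - ((S.norm b)⁻¹ * (u + S.tr b b')) • b)
      + S.cross (-S.inv b)
        (b' + S.cross b b'' - (u + S.tr b b' + S.tr b'' (S.sharp b)) • S.inv b)
      - (-((S.norm b)⁻¹ * u) + S.tr (-S.inv b)
          (S.cross (S.inv b) b' - ((S.norm b)⁻¹ * (u + S.tr b b')) • b)
        + S.tr (b' + S.cross b b'' - (u + S.tr b b' + S.tr b'' (S.sharp b)) • S.inv b)
            (S.sharp (-S.inv b))) • S.inv (-S.inv b) = -b'' := by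
  have hn := S.norm_ne_zero hb
  rw [map_neg S.tr (S.inv b), LinearMap.neg_apply, S.w_aux_tr hb, S.inv_neg, S.sharp_neg,
    S.inv_inv hb, S.sharp_inv hb]
  have e : S.tr (S.cross b b'') b = 2 * S.norm b * S.tr b'' (S.inv b) := by
    rw [S.tr_comm, S.tr_cross_self, S.sharp_eq hb, S.tr_comm b'']; simp; ring
  simp only [map_sub, map_add, map_neg, map_smul, LinearMap.neg_apply, LinearMap.add_apply,
    LinearMap.sub_apply, LinearMap.smul_apply, S.inv_cross_cross hb, S.cross_self, e,
    S.sharp_inv hb, S.tr_inv_self hb, S.sharp_eq hb, smul_eq_mul, S.tr_comm b' b,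
    S.tr_comm b'' (S.inv b)]
  match_scalars <;> field_simp <;> ring

lemma wPoint_wPoint (p : HexPoint F J) : S.wPoint (S.wPoint p) = w2Point p := by
  cases p
  case p0 => rfl
  case p1 t => simp [wPoint, w2Point]
  case p3 t a t' => simp [wPoint, w2Point]
  case p5 t a t' a' t'' => simp [wPoint, w2Point, S.tr_comm a' a]; ring
  case p2 b u =>
    by_cases hb : b = 0
    · subst hb; simp [wPoint, w2Point]
    · have h1 := S.inv_ne_zero hb
      simp only [wPoint, w2Point, hb, if_false, neg_eq_zero, h1, S.w_aux2 hb]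
      rw [S.inv_neg, S.inv_inv hb, neg_neg]
  case p4 b u b' u' =>
    by_cases hb : b = 0
    · subst hb; simp [wPoint, w2Point]
    · have h1 := S.inv_ne_zero hb
      simp only [wPoint, w2Point, hb, if_false, neg_eq_zero, h1, S.w_aux2 hb, S.w_aux3 hb,
        S.w_aux4 hb]
      rw [S.inv_neg, S.inv_inv hb, neg_neg]

lemma wLine_wLine (l : HexLine F J) : S.wLine (S.wLine l) = w2Line l := by
  cases l
  case l0 => simp [wLine, w2Line]
  case l2 t a => simp [wLine, w2Line]
  case l4 t a t' a' => simp [wLine, w2Line]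
  case l1 b =>
    by_cases hb : b = 0
    · subst hb; simp [wLine, w2Line]
    · have h1 := S.inv_ne_zero hb
      simp only [wLine, w2Line, hb, if_false, neg_eq_zero, h1]
      rw [S.inv_neg, S.inv_inv hb, neg_neg]
  case l3 b u b' =>
    by_cases hb : b = 0
    · subst hb; simp [wLine, w2Line]
    · have h1 := S.inv_ne_zero hb
      simp only [wLine, w2Line, hb, if_false, neg_eq_zero, h1, S.w_aux2 hb, S.w_aux3 hb]
      rw [S.inv_neg, S.inv_inv hb, neg_neg]
  case l5 b u b' u' b'' =>
    by_cases hb : b = 0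
    · subst hb; simp [wLine, w2Line]
    · have h1 := S.inv_ne_zero hb
      simp only [wLine, w2Line, hb, if_false, neg_eq_zero, h1, S.w_aux2 hb, S.w_aux3 hb,
        S.w_aux4 hb, S.w_aux5 hb]
      rw [S.inv_neg, S.inv_inv hb, neg_neg]

lemma w_inc55 {b : J} (hb : b ≠ 0) (t u : F) (b' : J) (u' : F) (b'' : J)
    {a : J} {t' : F} {a' : J} {t'' : F}
    (h : S.Inc (p5 t a t' a' t'') (l5 b u b' u' b'')) :
    S.Inc (S.wPoint (p5 t a t' a' t'')) (S.wLine (l5 b u b' u' b'')) := by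
  obtain ⟨rfl, rfl, rfl, rfl⟩ := h
  have hn := S.norm_ne_zero hb
  have e1 : S.tr (S.cross b b'') b = 2 * S.norm b * S.tr (S.inv b) b'' := by
    rw [S.tr_comm, S.tr_cross_self, S.sharp_eq hb]; simp; ring
  have e2 : S.tr (S.cross (S.inv b) b') b' = 2 * S.tr (S.inv b) (S.sharp b') := by
    rw [← S.tr_cross, S.cross_self]; simp
  have e3 : S.tr (S.cross (S.inv b) b') (S.cross b b'')
      = S.tr b' b'' + S.tr (S.inv b) b'' * S.tr b b' := by
    rw [S.cross_comm, ← S.tr_cross, S.inv_cross_cross hb, S.tr_comm b b']; simp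
  have e4 : S.tr (S.cross (S.inv b) b') (S.inv b) = 2 * ((S.norm b)⁻¹ * S.tr b b') := by
    rw [S.tr_comm, S.tr_inv_cross_inv hb]
  have e5 : S.tr b (S.cross b b'') = 2 * S.norm b * S.tr (S.inv b) b'' := by
    rw [S.tr_comm, e1]
  have e6 : S.tr (S.cross b' (S.cross b b'')) (S.inv b)
      = S.tr b' b'' + S.tr (S.inv b) b'' * S.tr b b' := by
    rw [← S.tr_cross, S.cross_comm _ (S.inv b), S.inv_cross_cross hb, S.tr_comm b b']; simp
  have e7 : S.tr (S.sharp (S.cross b b'')) (S.inv b)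
      = S.norm b * S.tr (S.inv b) b'' ^ 2 + S.tr b (S.sharp b'') := by
    rw [S.tr_comm, S.tr_inv_sharp_cross hb]
  have e8 : S.tr (S.cross b' (S.inv b)) (S.inv b) = 2 * ((S.norm b)⁻¹ * S.tr b b') := by
    rw [S.cross_comm, e4]
  have e9 : S.tr (S.cross (S.cross b b'') (S.inv b)) (S.inv b) = 4 * S.tr (S.inv b) b'' := by
    rw [← S.tr_cross, S.cross_self, S.sharp_inv hb]
    simp only [map_smul, e1, smul_eq_mul]; field_simp; ring
  have e10 : S.tr b'' (S.cross b b'') = 2 * S.tr b (S.sharp b'') := by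
    rw [S.tr_cross_self', S.tr_comm]
  have e11 : S.tr b (S.inv b) = 3 := by rw [S.tr_comm, S.tr_inv_self hb]
  simp only [wPoint, wLine, hb, if_false, Inc]
  refine ⟨?_, ?_, ?_, ?_⟩
  · simp only [S.sharp_eq hb, map_smul, smul_eq_mul]
    module
  · rw [S.sharp_neg, S.sharp_inv hb, S.norm_neg, S.norm_inv]
    simp only [S.sharp_eq hb, S.sharp_sub, S.sharp_add, S.sharp_smul, S.sharp_inv hb, map_smul,
      map_add, map_sub, map_neg, LinearMap.add_apply, LinearMap.sub_apply, LinearMap.smul_apply,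
      LinearMap.neg_apply, smul_eq_mul, e1, e2, e3, e4, e5, e6, e7, e8, e9, e10, e11,
      S.tr_comm b'' (S.inv b), S.tr_comm b' b, S.tr_comm b'' b', S.tr_comm b' (S.inv b),
      S.tr_comm (S.sharp b'') b, S.tr_comm (S.sharp b') (S.inv b), S.tr_inv_self hb]
    field_simp
    ring
  · rw [S.sharp_neg, S.sharp_inv hb]
    simp only [S.sharp_eq hb, map_smul, map_add, map_sub, map_neg, LinearMap.neg_apply,
      smul_eq_mul, S.inv_cross_cross hb, S.cross_self, S.sharp_inv hb, S.tr_comm b'' (S.inv b)]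
    match_scalars <;> field_simp <;> ring
  · rw [map_neg S.tr (S.inv b), LinearMap.neg_apply, S.w_aux_tr hb, S.sharp_neg, S.sharp_inv hb,
      S.norm_neg, S.norm_inv]
    simp only [S.sharp_eq hb, map_smul, map_add, map_sub, LinearMap.add_apply,
      LinearMap.sub_apply, LinearMap.smul_apply, smul_eq_mul, e1, S.tr_inv_self hb,
      S.tr_comm b' b, S.tr_comm b'' (S.inv b)]
    field_simp
    ring

lemma w_inc {p : HexPoint F J} {l : HexLine F J} (h : S.Inc p l) :
    S.Inc (S.wPoint p) (S.wLine l) := by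
  cases p <;> cases l
  case p5.l5 t a t' a' t'' b u b' u' b'' =>
    by_cases hb : b = 0
    · subst hb
      obtain ⟨rfl, rfl, rfl, rfl⟩ := h
      simp [wPoint, wLine, Inc, S.norm_zero, S.sharp_zero, S.tr_comm b'' b']
      ring
    · exact S.w_inc55 hb t u b' u' b'' h
  case p2.l1 b u b₁ =>
    obtain rfl := h
    by_cases hb : b = 0 <;> simp [wPoint, wLine, Inc, hb]
  case p2.l3 b u b₁ u₁ b₁' =>
    obtain ⟨rfl, rfl⟩ := h
    by_cases hb : b = 0 <;> simp [wPoint, wLine, Inc, hb]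
  case p4.l3 b u b' u' b₁ u₁ b₁' =>
    obtain ⟨rfl, rfl, rfl⟩ := h
    by_cases hb : b = 0 <;> simp [wPoint, wLine, Inc, hb]
  case p4.l5 b u b' u' b₁ u₁ b₁' u₁' b'' =>
    obtain ⟨rfl, rfl, rfl, rfl⟩ := h
    by_cases hb : b = 0 <;> simp [wPoint, wLine, Inc, hb]
  case p0.l1 b =>
    by_cases hb : b = 0 <;> simp [wPoint, wLine, Inc, hb]
  case p5.l4 t a t' a' t'' t₁ a₁ t₁' a₁' =>
    obtain ⟨rfl, rfl, rfl, rfl⟩ := h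
    simp [wPoint, wLine, Inc, S.norm_zero, S.sharp_zero, S.tr_comm a' a]
    ring
  all_goals simp_all [wPoint, wLine, Inc]

lemma wPoint_pow_four (p : HexPoint F J) :
    S.wPoint (S.wPoint (S.wPoint (S.wPoint p))) = p := by
  rw [S.wPoint_wPoint, S.wPoint_wPoint]
  cases p <;> simp [w2Point]

lemma wLine_pow_four (l : HexLine F J) : S.wLine (S.wLine (S.wLine (S.wLine l))) = l := by
  rw [S.wLine_wLine, S.wLine_wLine]
  cases l <;> simp [w2Line]

/-- The collineation `w`, a reflection of the base apartment. -/
def w : S.collineationGroup :=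
  ⟨(⟨S.wPoint, fun p => S.wPoint (S.wPoint (S.wPoint p)), S.wPoint_pow_four, S.wPoint_pow_four⟩,
    ⟨S.wLine, fun l => S.wLine (S.wLine (S.wLine l)), S.wLine_pow_four, S.wLine_pow_four⟩),
    fun p l => ⟨fun h => by
      have := S.w_inc (S.w_inc (S.w_inc (p := S.wPoint p) (l := S.wLine l) h))
      rwa [S.wPoint_pow_four, S.wLine_pow_four] at this, S.w_inc⟩⟩

/-- The root elations `x₇(a)` for the root opposite to that of `x₁`. -/
def x₇ (a : J) : S.collineationGroup := S.w * S.x₁ a * S.w⁻¹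

/-- `s₁(a) = x₇(a⁻¹) x₁(a) x₇(a⁻¹)`. -/
def s₁ (a : J) : S.collineationGroup := S.x₇ (S.inv a) * S.x₁ a * S.x₇ (S.inv a)

/-! ### The element `s₁(1)` is the reflection `w` -/

/-- A collineation that fixes every point `(t, a, t', a', t'')` is trivial. -/
lemma eq_one_of_fixes (g : S.collineationGroup)
    (hg : ∀ t a t' a' t'', g.1.1 (p5 t a t' a' t'') = p5 t a t' a' t'') : g = 1 := by
  have hinc := g.2
  have hl4 : ∀ t a t' a', g.1.2 (l4 t a t' a') = l4 t a t' a' := by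
    intro t a t' a'
    have h0 := (hinc (p5 t a t' a' 0) (l4 t a t' a')).2 (by simp [Inc])
    have h1 := (hinc (p5 t a t' a' 1) (l4 t a t' a')).2 (by simp [Inc])
    rw [hg] at h0 h1
    cases hm : g.1.2 (l4 t a t' a') <;> rw [hm] at h0 h1 <;> simp only [Inc] at h0 h1
    · simp [h0]
    · exact absurd (h0.2.2.2.trans h1.2.2.2.symm) (by simp)
  have hl5 : ∀ b u b' u' b'', g.1.2 (l5 b u b' u' b'') = l5 b u b' u' b'' := by
    intro b u b' u' b''
    have h0 := (hinc (p5 0 _ _ _ _) (l5 b u b' u' b'')).2 ⟨rfl, rfl, rfl, rfl⟩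
    have h1 := (hinc (p5 1 _ _ _ _) (l5 b u b' u' b'')).2 ⟨rfl, rfl, rfl, rfl⟩
    rw [hg] at h0 h1
    cases hm : g.1.2 (l5 b u b' u' b'') <;> rw [hm] at h0 h1 <;> simp only [Inc] at h0 h1
    · exact absurd (h0.1.trans h1.1.symm) (by simp)
    · obtain ⟨a0, b0, c0, d0⟩ := h0
      obtain ⟨a1, b1, c1, d1⟩ := h1
      simp only [zero_smul, sub_zero] at a0
      subst a0
      simp only [one_smul, sub_right_inj] at a1
      subst a1
      simp only [zero_smul, sub_zero, add_left_inj] at c0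
      subst c0
      simp at d0
      subst d0
      simp at b0
      subst b0
      rfl
  have hp4 : ∀ b u b' u', g.1.1 (p4 b u b' u') = p4 b u b' u' := by
    intro b u b' u'
    have h0 := (hinc (p4 b u b' u') (l5 b u b' u' 0)).2 (by simp [Inc])
    have h1 := (hinc (p4 b u b' u') (l5 b u b' u' S.one)).2 (by simp [Inc])
    rw [hl5] at h0 h1
    cases hm : g.1.1 (p4 b u b' u') <;> rw [hm] at h0 h1 <;> simp only [Inc] at h0 h1
    · simp [h0]
    · exact absurd (h0.1.symm.trans h1.1) (fun h => S.one_ne_zero.symm (sub_left_injective h))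
  have hp3 : ∀ t a t', g.1.1 (p3 t a t') = p3 t a t' := by
    intro t a t'
    have h0 := (hinc (p3 t a t') (l4 t a t' 0)).2 (by simp [Inc])
    have h1 := (hinc (p3 t a t') (l4 t a t' S.one)).2 (by simp [Inc])
    rw [hl4] at h0 h1
    cases hm : g.1.1 (p3 t a t') <;> rw [hm] at h0 h1 <;> simp only [Inc] at h0 h1
    · simp [h0]
    · exact absurd (h0.2.2.2.symm.trans h1.2.2.2) S.one_ne_zero.symm
  have hl3 : ∀ b u b', g.1.2 (l3 b u b') = l3 b u b' := by
    intro b u b'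
    have h0 := (hinc (p4 b u b' 0) (l3 b u b')).2 (by simp [Inc])
    have h1 := (hinc (p4 b u b' 1) (l3 b u b')).2 (by simp [Inc])
    rw [hp4] at h0 h1
    cases hm : g.1.2 (l3 b u b') <;> rw [hm] at h0 h1 <;> simp only [Inc] at h0 h1
    · simp [h0]
    · exact absurd (h0.2.2.2.trans h1.2.2.2.symm) (by simp)
  have hl2 : ∀ t a, g.1.2 (l2 t a) = l2 t a := by
    intro t a
    have h0 := (hinc (p3 t a 0) (l2 t a)).2 (by simp [Inc])
    have h1 := (hinc (p3 t a 1) (l2 t a)).2 (by simp [Inc])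
    rw [hp3] at h0 h1
    cases hm : g.1.2 (l2 t a) <;> rw [hm] at h0 h1 <;> simp only [Inc] at h0 h1
    · simp [h0]
    · exact absurd (h0.2.2.trans h1.2.2.symm) (by simp)
  have hp2 : ∀ b u, g.1.1 (p2 b u) = p2 b u := by
    intro b u
    have h0 := (hinc (p2 b u) (l3 b u 0)).2 (by simp [Inc])
    have h1 := (hinc (p2 b u) (l3 b u S.one)).2 (by simp [Inc])
    rw [hl3] at h0 h1
    cases hm : g.1.1 (p2 b u) <;> rw [hm] at h0 h1 <;> simp only [Inc] at h0 h1
    · simp [h0]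
    · exact absurd (h0.2.2.symm.trans h1.2.2) S.one_ne_zero.symm
  have hp1 : ∀ t, g.1.1 (p1 t) = p1 t := by
    intro t
    have h0 := (hinc (p1 t) (l2 t 0)).2 (by simp [Inc])
    have h1 := (hinc (p1 t) (l2 t S.one)).2 (by simp [Inc])
    rw [hl2] at h0 h1
    cases hm : g.1.1 (p1 t) <;> rw [hm] at h0 h1 <;> simp only [Inc] at h0 h1
    · simp [h0]
    · exact absurd (h0.2.symm.trans h1.2) S.one_ne_zero.symm
  have hl1 : ∀ b, g.1.2 (l1 b) = l1 b := by
    intro b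
    have h0 := (hinc (p2 b 0) (l1 b)).2 (by simp [Inc])
    have h1 := (hinc (p2 b 1) (l1 b)).2 (by simp [Inc])
    rw [hp2] at h0 h1
    cases hm : g.1.2 (l1 b) <;> rw [hm] at h0 h1 <;> simp only [Inc] at h0 h1
    · simp [h0]
    · exact absurd (h0.2.trans h1.2.symm) (by simp)
  have hl0 : g.1.2 l0 = l0 := by
    have h0 := (hinc (p1 0) l0).2 (by simp [Inc])
    have h1 := (hinc (p1 1) l0).2 (by simp [Inc])
    rw [hp1] at h0 h1
    cases hm : g.1.2 l0 <;> rw [hm] at h0 h1 <;> simp only [Inc] at h0 h1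
    · exact absurd (h0.trans h1.symm) (by simp)
  have hp0 : g.1.1 p0 = p0 := by
    have h0 := (hinc p0 (l1 0)).2 (by simp [Inc])
    have h1 := (hinc p0 (l1 S.one)).2 (by simp [Inc])
    rw [hl1] at h0 h1
    cases hm : g.1.1 p0 <;> rw [hm] at h0 h1 <;> simp only [Inc] at h0 h1
    · exact absurd (h0.symm.trans h1) S.one_ne_zero.symm
  apply Subtype.ext
  apply Prod.ext
  · ext p
    cases p <;> simp [hp0, hp1, hp2, hp3, hp4, hg]
  · ext l
    cases l <;> simp [hl0, hl1, hl2, hl3, hl4, hl5]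

lemma norm_one : S.norm S.one = 1 := by
  have h := S.sharp_sharp S.one
  rw [S.sharp_one, S.sharp_one] at h
  have h' : (1 : F) • S.one = S.norm S.one • S.one := by rw [one_smul]; exact h
  exact (smul_left_injective F S.one_ne_zero h').symm

lemma inv_one : S.inv S.one = S.one := by simp [inv, S.norm_one, S.sharp_one]

lemma cross_one (a : J) : S.cross S.one a = S.tr a S.one • S.one - a := by
  have h := S.eq_tr_sub a
  rw [eq_sub_iff_add_eq] at h
  rw [← h]; abel

lemma w_sq_mul_x₁ (c : J) : S.w * S.w * S.x₁ c = S.x₁ c * (S.w * S.w) := by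
  apply Subtype.ext
  apply Prod.ext
  · ext p
    change S.wPoint (S.wPoint (S.x₁Point c p)) = S.x₁Point c (S.wPoint (S.wPoint p))
    rw [S.wPoint_wPoint, S.wPoint_wPoint]
    cases p <;> simp [w2Point, x₁Point, S.sharp_neg, S.norm_neg]
    · abel
    · exact ⟨by abel, by abel, by ring⟩
  · ext l
    change S.wLine (S.wLine (S.x₁Line c l)) = S.x₁Line c (S.wLine (S.wLine l))
    rw [S.wLine_wLine, S.wLine_wLine]
    cases l <;> simp [w2Line, x₁Line, S.sharp_neg, S.norm_neg]
    · abel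
    · exact ⟨by abel, by abel⟩

lemma x₁_one_w_pow_three : (S.x₁ S.one * S.w) ^ 3 = 1 := by
  apply S.eq_one_of_fixes
  intro t a t' a' t''
  have e3 : S.tr S.one S.one = 3 := by
    have := S.tr_sharp S.one
    rwa [S.sharp_one, S.norm_one, mul_one] at this
  rw [pow_three]
  change S.x₁Point S.one (S.wPoint (S.x₁Point S.one (S.wPoint (S.x₁Point S.one (S.wPoint
    (p5 t a t' a' t'')))))) = _
  simp only [wPoint, x₁Point, S.norm_one, S.sharp_one, S.cross_one]
  have e4 : ∀ x y, S.tr S.one (S.cross x y) = S.tr x S.one * S.tr y S.one - S.tr x y := by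
    intro x y
    rw [S.tr_cross, S.cross_one]
    simp [S.tr_comm S.one y]
  have e5 : ∀ x, S.cross x S.one = S.tr x S.one • S.one - x := fun x => by
    rw [S.cross_comm, S.cross_one]
  have e6 : ∀ x, S.tr x x = S.tr x S.one ^ 2 - 2 * S.tr (S.sharp x) S.one := fun x => by
    have := e4 x x
    rw [S.cross_self, map_smul, smul_eq_mul, S.tr_comm S.one] at this
    rw [this]; ring
  simp only [HexPoint.p5.injEq, S.sharp_sub, S.sharp_add, S.sharp_smul, S.sharp_neg, S.sharp_one,
    map_sub, map_add, map_neg, map_smul, LinearMap.sub_apply, LinearMap.add_apply,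
    LinearMap.neg_apply, LinearMap.smul_apply, smul_eq_mul, e3, e4, e5, S.tr_comm S.one a,
    S.tr_comm S.one a', S.tr_comm a' a, S.tr_comm S.one (S.sharp a), e6,
    S.tr_comm S.one (S.sharp a')]
  refine ⟨by ring, by module, by ring, by module, by ring⟩

/-- `s₁(1)` is the reflection `w`; in particular it stabilises the base apartment. -/
theorem s₁_one : S.s₁ S.one = S.w := by
  have h3 := S.x₁_one_w_pow_three
  have hc := S.w_sq_mul_x₁ S.one
  have h4 : S.w * S.w * (S.w * S.w) = 1 := by
    apply Subtype.ext
    apply Prod.ext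
    · ext p
      exact S.wPoint_pow_four p
    · ext l
      exact S.wLine_pow_four l
  have hw : S.w⁻¹ = S.w * (S.w * S.w) := by
    rw [inv_eq_iff_mul_eq_one, ← h4]; group
  rw [s₁, x₇, S.inv_one, hw]
  generalize S.w = w at *
  generalize S.x₁ S.one = x at *
  have hz : w * w * w * w = 1 := by rw [← h4]; group
  calc w * x * (w * (w * w)) * x * (w * x * (w * (w * w)))
      = w * x * w * ((w * w) * x) * (w * x * (w * (w * w))) := by group
    _ = w * x * w * (x * (w * w)) * (w * x * (w * (w * w))) := by rw [hc]
    _ = w * x * w * x * w * ((w * w) * x) * (w * (w * w)) := by group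
    _ = w * x * w * x * w * (x * (w * w)) * (w * (w * w)) := by rw [hc]
    _ = w * (x * w) ^ 3 * (w * w * w * w) := by rw [pow_three]; group
    _ = w := by rw [h3, hz]; simp

end

end HexagonalSystem


/-!
Write a point `(t, a, t', a', t'')` as the coset `g • o` of some `g ∈ U₊`, where
`o = (0, 0, 0, 0, 0)`. There is a quartic form on `U₊`, invariant under left and right
multiplication by `U₁`, such that `g • o` and `(g * k) • o` are not opposite whenever the form
vanishes at `k`. By the two trace identities, `θ` sends `g • o` to some `(g * k) • o` with `k` a
zero of the form.

Now take a point `(b, u, b', u')` with `b ≠ 0`, with image `(c, v, c', v')`. If `c ≠ b`, some point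
`g • o` is collinear both with `(b, u, b', u')` and with some `(c, v, c', w)`. The form is
`(v' - w) ^ 2` at the element `k` which carries `g • o` to `θ (g • o)`, whence `w = v'`. If
`c = b`, comparing the norms and traces of `b` and `1 - b⁻¹` gives `N(b) = -1`, so that `θ` fixes
the point `(b, u)`. The remaining points are joined to their images by explicit paths.
-/

namespace HexagonalSystem

open HexPoint HexLine

variable {F J : Type*} [Field F] [AddCommGroup J] [Module F J] (S : HexagonalSystem F J)

lemma trace_one : S.trace S.one = 3 := by
  have h := S.tr_sharp S.one
  rwa [S.sharp_one, S.norm_one, mul_one] at h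

lemma norm_add_smul_one (a : J) (s : F) : S.norm (a + s • S.one) =
    S.norm a + s * S.trace (S.sharp a) + s ^ 2 * S.trace a + s ^ 3 := by
  rw [S.norm_add, S.sharp_smul, S.norm_smul, S.norm_one, S.sharp_one]
  simp [trace]

lemma trace_sharp_add_smul_one (a : J) (s : F) : S.trace (S.sharp (a + s • S.one)) =
    S.trace (S.sharp a) + 2 * s * S.trace a + 3 * s ^ 2 := by
  have h₁ := S.trace_one
  unfold trace at *
  rw [S.sharp_add, S.sharp_smul, S.sharp_one, map_smul, S.cross_comm, S.cross_one]
  simp only [map_add, map_sub, map_smul, LinearMap.add_apply, LinearMap.sub_apply,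
    LinearMap.smul_apply, smul_eq_mul, h₁]
  ring

lemma norm_eq_neg_one_of_trace_eq {a : J} (htrace : S.trace a = S.norm a + 1)
    (hsharp : S.trace (S.sharp a) = S.norm a * (3 - S.trace a))
    (hnorm : S.norm a ^ 2 - S.norm a + 1 = 0) : S.norm a = -1 := by
  have hscalar : a = S.norm a • S.one := by
    rw [← sub_eq_zero, sub_eq_add_neg, ← neg_smul, ← S.norm_eq_zero_iff, norm_add_smul_one, hsharp,
      htrace]
    linear_combination S.norm a * hnorm
  have hcube : S.norm a = S.norm a ^ 3 := by
    conv_lhs => rw [hscalar, S.norm_smul, S.norm_one, mul_one]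
  linear_combination hcube + (S.norm a + 1) * hnorm

lemma tr_cross_left_comm (a b c : J) : S.tr a (S.cross b c) = S.tr b (S.cross a c) := by
  rw [S.tr_cross, S.cross_comm a, ← S.tr_cross]

lemma sharp_cross (a b : J) : S.sharp (S.cross a b) =
    S.tr (S.sharp a) b • b + S.tr a (S.sharp b) • a - S.cross (S.sharp a) (S.sharp b) :=
  eq_sub_of_add_eq' (S.sharp_cross_sharp a b)

lemma sharp_cross_cross_right (a b : J) : S.cross (S.sharp (S.cross a b)) b =
    S.tr (S.sharp a) b • S.sharp b + S.tr a (S.sharp b) • S.cross a b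
      - S.norm b • S.sharp a := by
  have h := S.cross_cross_sharp b (S.sharp a)
  rw [S.cross_comm (S.sharp b), S.cross_comm b] at h
  rw [sharp_cross]
  simp only [map_add, map_sub, map_smul, LinearMap.add_apply, LinearMap.sub_apply,
    LinearMap.smul_apply, h, S.cross_self, S.tr_comm b]
  module

lemma norm_cross (a b : J) : S.norm (S.cross a b) =
    S.tr (S.sharp a) b * S.tr a (S.sharp b) - S.norm a * S.norm b := by
  by_cases ha : a = 0
  · simp only [ha, map_zero, LinearMap.zero_apply, S.norm_zero, mul_zero, zero_mul, sub_zero]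
  have hab := S.sharp_cross_cross_right a b
  have hba := S.sharp_cross_cross_right b a
  rw [S.cross_comm b a, S.tr_comm (S.sharp b), S.tr_comm b] at hba
  -- Expand `(a × b)^# × ((a × b) × a^#)` in two ways and compare the coefficients of `a^#`.
  have h := S.sharp_cross_cross (S.cross a b) (S.sharp a)
  rw [S.cross_comm (S.cross a b) (S.sharp a), S.sharp_cross_cross, map_add, map_smul, map_smul,
    hab, hba, S.tr_comm (S.sharp (S.cross a b)), S.tr_sharp_cross] at h
  apply smul_left_injective F (S.sharp_ne_zero ha)
  rw [← sub_eq_zero] at h ⊢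
  rw [← neg_eq_zero, ← h]
  module

lemma exists_cross_sub_smul_sharp {a : J} (ha : a ≠ 0) (c : J) (v : F) : ∃ (x : J) (t : F),
    S.cross a x - t • S.sharp a = c ∧ S.tr (S.sharp a) x - t * S.norm a = v := by
  have hn := S.norm_ne_zero ha
  refine ⟨(S.norm a)⁻¹ • (S.cross (S.sharp a) c + (v - S.tr a c) • a),
    (S.norm a)⁻¹ * (2 * v - S.tr a c), ?_, ?_⟩
  · simp only [map_smul, map_add, S.cross_cross_sharp, S.cross_self]
    match_scalars <;> field_simp
    ring
  · simp only [map_smul, map_add, S.tr_cross_self, S.sharp_sharp, LinearMap.smul_apply,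
      S.tr_sharp', smul_eq_mul]
    field_simp
    ring

/-- Two points of the hexagon are collinear if some line passes through both of them. -/
def Collinear (p q : HexPoint F J) : Prop := ∃ l, S.Inc p l ∧ S.Inc q l

/-- Two points of the hexagon are close if some point is collinear with both of them, that is, if
their distance in the incidence graph is at most `4`. -/
def Close (p q : HexPoint F J) : Prop := ∃ r, S.Collinear p r ∧ S.Collinear r q

variable {S}

lemma Inc.adj {p : HexPoint F J} {l : HexLine F J} (h : S.Inc p l) :
    S.incGraph.Adj (Sum.inl p) (Sum.inr l) := by
  rw [incGraph, SimpleGraph.fromRel_adj]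
  exact ⟨Sum.inl_ne_inr, Or.inl ⟨p, l, rfl, rfl, h⟩⟩

lemma Close.not_opposite {p q : HexPoint F J} (h : S.Close p q) :
    ¬ S.Opposite (Sum.inl p) (Sum.inl q) := by
  obtain ⟨r, ⟨l, hpl, hrl⟩, m, hrm, hqm⟩ := h
  intro hopp
  have hdist := SimpleGraph.dist_le (.cons hpl.adj (.cons hrl.adj.symm
    (.cons hrm.adj (.cons hqm.adj.symm .nil))))
  rw [Opposite] at hopp
  simp only [SimpleGraph.Walk.length_cons, SimpleGraph.Walk.length_nil] at hdist
  omega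

namespace UPlus

/-- The point `(t, a, t', a', t'')` that stands for the coset of an element of `U₊`. -/
def toPoint (g : UPlus S) : HexPoint F J := p5 g.t g.a g.t' g.a' g.t''

lemma toPoint_mul_congr (g : UPlus S) {k k' : UPlus S} (h : k.toPoint = k'.toPoint) :
    (g * k).toPoint = (g * k').toPoint := by
  simp only [toPoint, p5.injEq] at h
  obtain ⟨ht, ha, ht', ha', ht''⟩ := h
  simp only [toPoint, mul_def, ht, ha, ht', ha', ht'']

lemma toPoint_mul_y₁ (g : UPlus S) (c : J) : (g * y₁ S c).toPoint = g.toPoint := by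
  simp [toPoint, mul_def, y₁, S.sharp_zero]

lemma y₁_mul_y₁ (b c : J) : y₁ S b * y₁ S c = y₁ S (b + c) := by
  ext <;> simp [mul_def, y₁, S.sharp_zero]

lemma y₁_zero : y₁ S 0 = 1 := rfl

lemma y₅_zero : y₅ S 0 = 1 := rfl

lemma y₆_zero : y₆ S 0 = 1 := rfl

lemma inc_toPoint_iff {g : UPlus S} {b : J} {u : F} {b' : J} {u' : F} {b'' : J} :
    S.Inc g.toPoint (l5 b u b' u' b'') ↔ ∃ (c : J) (s : F),
      g * y₁ S c = y₁ S b * y₂ S u * y₃ S b' * y₄ S u' * y₅ S b'' * y₆ S s := by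
  have hg (c : J) : g * y₁ S c = ⟨g.t, g.a, g.t', g.a', g.t'', g.c + c⟩ := by
    ext <;> simp [mul_def, y₁, S.sharp_zero]
  rw [toPoint, inc_iff_cosets_meet]
  simp only [normal_form, hg]
  exact ⟨fun ⟨c, s, h⟩ => ⟨c - g.c, s, by rwa [add_sub_cancel]⟩, fun ⟨c, h⟩ => ⟨g.c + c, h⟩⟩

lemma exists_eq_mul (g : UPlus S) : ∃ (b : J) (u : F) (b' : J) (u' : F) (b'' : J) (s : F),
    g = y₁ S b * y₂ S u * y₃ S b' * y₄ S u' * y₅ S b'' * y₆ S s := by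
  obtain ⟨b'', hb''⟩ : ∃ b'', g.a = b'' - g.t • g.c := ⟨_, (add_sub_cancel_right _ _).symm⟩
  obtain ⟨b', hb'⟩ : ∃ b', g.a' = b' + (S.cross g.c b'' - g.t • S.sharp g.c) :=
    ⟨_, (sub_add_cancel _ _).symm⟩
  obtain ⟨u, hu⟩ : ∃ u, g.t'' = u + (S.tr g.c b' + S.tr b'' (S.sharp g.c) - g.t * S.norm g.c) :=
    ⟨_, (sub_add_cancel _ _).symm⟩
  obtain ⟨u', hu'⟩ : ∃ u', g.t' = u' + (g.t ^ 2 * S.norm g.c + u * g.t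
      - g.t * S.tr b'' (S.sharp g.c) + S.tr b' b'' + S.tr (S.sharp b'') g.c) :=
    ⟨_, (sub_add_cancel _ _).symm⟩
  have hinc : S.Inc g.toPoint (l5 g.c u b' u' b'') :=
    ⟨hb'', hu'.trans (by ring), hb'.trans (by abel), hu.trans (by ring)⟩
  obtain ⟨c, s, h⟩ := inc_toPoint_iff.1 hinc
  have hc : c = 0 := by simpa [mul_def, y₁, y₂, y₃, y₄, y₅, y₆] using congrArg UPlus.c h
  rw [hc, y₁_zero, mul_one] at h
  exact ⟨_, _, _, _, _, s, h⟩

lemma exists_inc_mul_y₅_mul_y₆ (g : UPlus S) : ∃ (b : J) (u : F) (b' : J) (u' : F) (b'' : J),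
    ∀ (d : J) (r : F), S.Inc (g * y₅ S d * y₆ S r).toPoint (l5 b u b' u' (b'' + d)) := by
  obtain ⟨b, u, b', u', b'', s, hg⟩ := g.exists_eq_mul
  refine ⟨b, u, b', u', b'', fun d r => inc_toPoint_iff.2 ⟨0, s + r, ?_⟩⟩
  have h : y₅ S b'' * (y₆ S s * (y₅ S d * y₆ S r)) = y₅ S (b'' + d) * y₆ S (s + r) := by
    ext <;> simp [mul_def, y₅, y₆, S.sharp_zero, S.norm_zero]
  rw [hg, y₁_zero, mul_one]
  simp only [mul_assoc, h]

lemma collinear_mul_y₆ (g : UPlus S) (r : F) : S.Collinear g.toPoint (g * y₆ S r).toPoint := by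
  obtain ⟨b, u, b', u', b'', h⟩ := g.exists_inc_mul_y₅_mul_y₆
  have h₀ := h 0 0
  have hr := h 0 r
  rw [y₅_zero, mul_one] at h₀ hr
  rw [y₆_zero, mul_one] at h₀
  exact ⟨_, h₀, hr⟩

lemma collinear_mul_y₂ (g : UPlus S) (u : F) : S.Collinear g.toPoint (g * y₂ S u).toPoint :=
  ⟨l4 g.t g.a g.t' g.a', ⟨rfl, rfl, rfl, rfl⟩,
    by simp [toPoint, Inc, mul_def, y₂, S.sharp_zero]⟩

/-- An element `k` of `U₊` is near if right multiplication by `k` moves every point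
`(t, a, t', a', t'')` to a close one. By left invariance this is a condition on the point
`(0, 0, 0, 0, 0)` alone, but quantifying over all points avoids using the action of `U₊`. -/
def Near (k : UPlus S) : Prop := ∀ g : UPlus S, S.Close g.toPoint (g * k).toPoint

lemma Near.congr {k k' : UPlus S} (hk : k.Near) (h : k.toPoint = k'.toPoint) : k'.Near :=
  fun g => g.toPoint_mul_congr h ▸ hk g

lemma Near.of_y₁_mul {c : J} {k : UPlus S} (h : (y₁ S c * k).Near) : k.Near := fun g => by
  have hg := h (g * y₁ S (-c))
  rwa [toPoint_mul_y₁, mul_assoc, ← mul_assoc (y₁ S (-c)), y₁_mul_y₁, neg_add_cancel, y₁_zero,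
    one_mul] at hg

lemma near_y₆_mul_y₁_mul_y₆ (t : F) (c : J) (r : F) : (y₆ S t * y₁ S c * y₆ S r).Near := fun g => by
  have h := (g * y₆ S t * y₁ S c).collinear_mul_y₆ r
  rw [toPoint_mul_y₁] at h
  exact ⟨_, g.collinear_mul_y₆ t, by simpa only [mul_assoc] using h⟩

lemma near_y₅_mul_y₆ (d : J) (r : F) : (y₅ S d * y₆ S r).Near := fun g => by
  obtain ⟨b, u, b', u', b'', h⟩ := g.exists_inc_mul_y₅_mul_y₆
  refine ⟨p4 b u b' u', ⟨l5 b u b' u' b'', ?_, rfl, rfl, rfl, rfl⟩,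
    l5 b u b' u' (b'' + d), ⟨rfl, rfl, rfl, rfl⟩, by simpa only [mul_assoc] using h d r⟩
  simpa only [y₅_zero, y₆_zero, mul_one, add_zero] using h 0 0

lemma near_y₆_mul_y₂ (t u : F) : (y₆ S t * y₂ S u).Near := fun g =>
  ⟨_, g.collinear_mul_y₆ t, by simpa only [mul_assoc] using (g * y₆ S t).collinear_mul_y₂ u⟩

lemma near_y₂_mul_y₆ (u t : F) : (y₂ S u * y₆ S t).Near := fun g =>
  ⟨_, g.collinear_mul_y₂ u, by simpa only [mul_assoc] using (g * y₂ S u).collinear_mul_y₆ t⟩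

lemma near_y₃_mul_y₂ (a : J) (u : F) : (y₃ S a * y₂ S u).Near := fun g => by
  refine ⟨p3 g.t g.a g.t', ⟨l4 g.t g.a g.t' g.a', ⟨rfl, rfl, rfl, rfl⟩, rfl, rfl, rfl⟩,
    l4 g.t g.a g.t' (g.a' + a), ⟨rfl, rfl, rfl⟩, ?_⟩
  simp [toPoint, Inc, mul_def, y₂, y₃, S.sharp_zero]

/-- The quartic form on `U₊`. It is invariant under multiplication by `U₁` on either side, and its
zeros map `(0, 0, 0, 0, 0)` to a point that is not opposite to it. -/
def quartic (k : UPlus S) : F :=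
  k.t' ^ 2 - k.t' * (k.t * k.t'' + S.tr k.a k.a') + k.t * S.norm k.a' - k.t'' * S.norm k.a
    + S.tr (S.sharp k.a) (S.sharp k.a')

lemma quartic_congr {k k' : UPlus S} (h : k.toPoint = k'.toPoint) : k.quartic = k'.quartic := by
  simp only [toPoint, p5.injEq] at h
  obtain ⟨ht, ha, ht', ha', ht''⟩ := h
  simp only [quartic, ht, ha, ht', ha', ht'']

lemma quartic_y₁_mul (c : J) (k : UPlus S) : (y₁ S c * k).quartic = k.quartic := by
  obtain ⟨t, a, t', a', t'', k₁⟩ := k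
  have hmul : y₁ S c * ⟨t, a, t', a', t'', k₁⟩ = ⟨t, a - t • c,
      t' + t ^ 2 * S.norm c - t * S.tr (S.sharp c) a + S.tr c (S.sharp a),
      a' + S.cross c a - t • S.sharp c,
      t'' - t * S.norm c + S.tr (S.sharp c) a + S.tr c a', c + k₁⟩ := by
    ext <;> simp only [mul_def, y₁, map_zero, LinearMap.zero_apply, zero_mul, zero_add, add_zero]
  have hca : S.cross (S.sharp a) (S.cross c a) = S.norm a • c + S.tr (S.sharp a) c • a := by
    rw [S.cross_comm c, S.sharp_cross_cross]
  have hcc : S.cross (S.cross c a) (S.sharp c) = S.norm c • a + S.tr (S.sharp c) a • c := by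
    rw [S.cross_comm, S.sharp_cross_cross]
  have hac : S.cross (S.sharp a) (S.sharp c) = S.tr (S.sharp a) c • c + S.tr (S.sharp c) a • a
      - S.sharp (S.cross c a) := by
    rw [S.cross_comm c, S.sharp_cross, S.tr_comm a]; abel
  have hsa : S.tr (S.sharp a) (S.sharp (S.cross c a))
      = S.tr (S.sharp a) c ^ 2 + S.norm a * S.tr (S.sharp c) a := by
    rw [S.cross_comm, S.tr_sharp_cross, S.tr_comm a]
  have hsc : S.tr (S.sharp c) (S.sharp (S.cross c a))
      = S.tr (S.sharp c) a ^ 2 + S.norm c * S.tr (S.sharp a) c := by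
    rw [S.tr_sharp_cross, S.tr_comm c]
  rw [hmul]
  simp only [quartic, sub_eq_add_neg, S.sharp_add, S.sharp_neg, S.sharp_smul, S.sharp_sharp,
    S.norm_add, S.norm_neg, S.norm_smul, S.norm_sharp, S.norm_cross, map_add, map_neg, map_smul,
    LinearMap.add_apply, LinearMap.neg_apply, LinearMap.smul_apply, smul_eq_mul,
    ← S.tr_cross a' (S.cross c a), S.tr_cross_left_comm _ a', S.cross_comm a c, S.cross_self,
    S.sharp_cross_cross, hca, hcc, hac, S.tr_sharp, S.tr_sharp', S.tr_cross_self,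
    S.tr_cross_self', hsa, hsc, S.tr_comm (S.cross c a) a, S.tr_comm (S.cross c a) c,
    S.tr_comm (S.sharp (S.cross c a)) (S.sharp c), S.tr_comm (S.sharp a') (S.cross c a),
    S.tr_comm (S.sharp a') (S.sharp c), S.tr_comm c (S.sharp a), S.tr_comm a (S.sharp c),
    S.tr_comm a' a, S.tr_comm a' c]
  ring

lemma near_of_sharp_smul (t r : F) (a : J) :
    Near (⟨t, a, r * S.norm a, r • S.sharp a, r ^ 2 * S.norm a, 0⟩ : UPlus S) := by
  by_cases hr : r = 0
  · refine (near_y₅_mul_y₆ a t).congr ?_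
    simp [toPoint, mul_def, y₅, y₆, hr, S.sharp_zero, S.norm_zero]
  · refine (near_y₆_mul_y₁_mul_y₆ (t + r⁻¹) (r • a) (-r⁻¹)).congr ?_
    simp only [toPoint, mul_def, y₁, y₆, S.norm_smul, S.sharp_smul, S.sharp_zero, S.norm_zero,
      map_zero, LinearMap.zero_apply, zero_add, add_zero, sub_zero, zero_sub, smul_zero, mul_zero,
      p5.injEq]
    refine ⟨by ring, ?_, ?_, ?_, ?_⟩
    · match_scalars; field_simp
    · field_simp; ring
    · match_scalars; field_simp
    · field_simp

lemma near_of_t_eq_zero {k : UPlus S} (ht : k.t = 0) (h : k.quartic = 0) : k.Near := by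
  obtain ⟨t, a, t', a', t'', c⟩ := k
  obtain rfl : t = 0 := ht
  by_cases ha : a = 0
  · have ht' : t' = 0 := by simpa [quartic, ha, S.sharp_zero, S.norm_zero] using h
    refine (near_y₃_mul_y₂ a' t'').congr ?_
    simp [toPoint, mul_def, y₂, y₃, ha, ht', S.sharp_zero]
  obtain ⟨x, r, hx, hr⟩ := S.exists_cross_sub_smul_sharp ha (-a') (-t')
  have hmul : (y₁ S x * ⟨0, a, t', a', t'', c⟩).toPoint =
      p5 0 a (r * S.norm a) (r • S.sharp a) (t'' + S.tr (S.sharp x) a + S.tr x a') := by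
    simp only [toPoint, mul_def, y₁, map_zero, LinearMap.zero_apply, zero_smul, zero_add, zero_mul,
      mul_zero, sub_zero, add_zero, zero_pow two_ne_zero, p5.injEq, true_and]
    refine ⟨?_, ?_, trivial⟩
    · rw [S.tr_comm]
      linear_combination hr
    · rw [S.cross_comm, sub_eq_iff_eq_add.1 hx]
      abel
  generalize t'' + S.tr (S.sharp x) a + S.tr x a' = s at hmul
  have hs : s = r ^ 2 * S.norm a := by
    rw [← quartic_y₁_mul x, quartic_congr (k' := ⟨0, a, r * S.norm a, r • S.sharp a, s, 0⟩) hmul]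
      at h
    simp only [quartic, map_smul, smul_eq_mul, S.sharp_smul, S.sharp_sharp, S.tr_sharp,
      S.tr_sharp'] at h
    apply mul_left_cancel₀ (S.norm_ne_zero ha)
    linear_combination -h
  exact ((near_of_sharp_smul 0 r a).congr (hs ▸ hmul).symm).of_y₁_mul

lemma near_of_a_eq_zero {k : UPlus S} (ht : k.t ≠ 0) (ha : k.a = 0) (h : k.quartic = 0) :
    k.Near := by
  obtain ⟨t, a, t', a', t'', c⟩ := k
  obtain rfl : a = 0 := ha
  replace ht : t ≠ 0 := ht
  have hq : t' * (t' - t * t'') + t * S.norm a' = 0 := by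
    simp only [quartic, map_zero, LinearMap.zero_apply, S.sharp_zero, S.norm_zero] at h
    linear_combination h
  by_cases ha' : a' = 0
  · rw [ha', S.norm_zero, mul_zero, add_zero, mul_eq_zero, sub_eq_zero] at hq
    rcases hq with ht' | ht'
    · refine (near_y₆_mul_y₂ t t'').congr ?_
      simp [toPoint, mul_def, y₂, y₆, ha', ht', S.sharp_zero]
    · refine (near_y₂_mul_y₆ t'' t).congr ?_
      simp [toPoint, mul_def, y₂, y₆, ha', ht', S.sharp_zero, S.norm_zero, mul_comm]
  have hn := S.norm_ne_zero ha'
  have ht' : t' ≠ 0 := by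
    rintro rfl
    exact mul_ne_zero ht hn (by linear_combination hq)
  have ht'' : t'' = (t' ^ 2 + t * S.norm a') / (t * t') := by
    rw [eq_div_iff (mul_ne_zero ht ht')]
    linear_combination -hq
  refine Near.of_y₁_mul (c := -((t' / (t * S.norm a')) • S.sharp a'))
    ((near_of_sharp_smul t (S.norm a' / t' ^ 2 - t⁻¹) ((t' / S.norm a') • S.sharp a')).congr ?_)
  simp only [toPoint, mul_def, y₁, ht'', S.sharp_neg, S.sharp_smul, S.sharp_sharp, S.norm_neg,
    S.norm_smul, S.norm_sharp, map_neg, map_smul, map_zero, LinearMap.neg_apply,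
    LinearMap.smul_apply, LinearMap.zero_apply, S.tr_sharp', S.sharp_zero, smul_eq_mul, zero_mul,
    zero_add, add_zero, mul_zero, sub_zero, zero_sub, p5.injEq, true_and]
  refine ⟨?_, ?_, ?_, ?_⟩
  · match_scalars; field_simp
  · field_simp; ring
  · match_scalars; field_simp
  · field_simp; ring

theorem near_of_quartic_eq_zero {k : UPlus S} (h : k.quartic = 0) : k.Near := by
  by_cases ht : k.t = 0
  · exact near_of_t_eq_zero ht h
  refine (near_of_a_eq_zero (k := y₁ S (k.t⁻¹ • k.a) * k) ?_ ?_ ?_).of_y₁_mul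
  · simpa [mul_def, y₁] using ht
  · simp [mul_def, y₁, smul_inv_smul₀ ht]
  · rwa [quartic_y₁_mul]

lemma quartic_inv_mul_of_inc {g k : UPlus S} {b : J} {u : F} {b' : J} {u' v' : F} {b'' c'' : J}
    (hg : S.Inc g.toPoint (l5 b u b' u' b'')) (hk : S.Inc k.toPoint (l5 b u b' v' c'')) :
    (g⁻¹ * k).quartic = (v' - u') ^ 2 := by
  obtain ⟨c, s, hg⟩ := inc_toPoint_iff.1 hg
  obtain ⟨d, r, hk⟩ := inc_toPoint_iff.1 hk
  have hgk : y₄ S v' * y₅ S c'' * y₆ S r =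
      y₄ S u' * y₅ S b'' * y₆ S s * ⟨r - s, c'' - b'', v' - u', 0, 0, 0⟩ := by
    ext <;> simp [mul_def, y₄, y₅, y₆, S.sharp_zero, S.norm_zero]
  have hmul : k * y₁ S d = g * y₁ S c * ⟨r - s, c'' - b'', v' - u', 0, 0, 0⟩ := by
    rw [hg, hk]
    simp only [mul_assoc] at hgk ⊢
    rw [hgk]
  have hquot : g⁻¹ * k * y₁ S d = y₁ S c * ⟨r - s, c'' - b'', v' - u', 0, 0, 0⟩ := by
    rw [mul_assoc, hmul, mul_assoc, inv_mul_cancel_left]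
  rw [← quartic_congr (toPoint_mul_y₁ _ d), hquot, quartic_y₁_mul]
  simp [quartic, S.sharp_zero, S.norm_zero]

end UPlus

variable (S) in
lemma exists_inc_l5_inc_l5 {b c : J} (hbc : c ≠ b) (u : F) (b' : J) (u' v : F) (c' : J) :
    ∃ (g : UPlus S) (b'' : J) (v' : F) (c'' : J),
      S.Inc g.toPoint (l5 b u b' u' b'') ∧ S.Inc g.toPoint (l5 c v c' v' c'') := by
  suffices key : ∀ d : J, d ≠ 0 → ∃ (g : UPlus S) (b'' : J) (v' : F) (c'' : J),
      S.Inc g.toPoint (l5 0 u b' u' b'') ∧ S.Inc g.toPoint (l5 d v c' v' c'') by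
    obtain ⟨g, b'', v', c'', hg, hg'⟩ := key (c - b) (sub_ne_zero.2 hbc)
    -- Translation by `x₁(b)` carries the lines `[0]` and `[c - b]` to `[b]` and `[c]`.
    refine ⟨UPlus.y₁ S b * g, b'', v', c'', ?_, ?_⟩
    · simpa only [x₁Line, zero_add, UPlus.toPoint, UPlus.x₁Point_eq_mul] using S.x₁_inc b hg
    · simpa only [x₁Line, sub_add_cancel, UPlus.toPoint, UPlus.x₁Point_eq_mul] using
        S.x₁_inc b hg'
  intro d hd
  obtain ⟨c'', t, hc'', ht⟩ :=
    S.exists_cross_sub_smul_sharp hd (b' - c') (u - v - S.tr d c')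
  obtain ⟨t', ht'⟩ : ∃ t', t' = u' + u * t + S.tr b' (c'' - t • d) := ⟨_, rfl⟩
  refine ⟨⟨t, c'' - t • d, t', b', u, 0⟩, c'' - t • d, t' - (t ^ 2 * S.norm d + v * t
    - t * S.tr c'' (S.sharp d) + S.tr c' c'' + S.tr (S.sharp c'') d), c'', ⟨?_, ?_, ?_, ?_⟩,
    ⟨rfl, ?_, ?_, ?_⟩⟩
  · rw [smul_zero, sub_zero]
  · simp [ht', S.norm_zero, S.sharp_zero]
  · simp [S.sharp_zero]
  · simp [S.norm_zero, S.sharp_zero]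
  · ring
  · rw [add_sub_assoc, hc'', add_sub_cancel]
  · rw [S.tr_comm c'']
    linear_combination -ht

variable {h : J ≃ₗ[F] J}

variable (S h) in
/-- The action of `θ = h x₁(1) s₁` on points, with `s₁` given by the explicit map `w`. -/
noncomputable def thetaPoint (p : HexPoint F J) : HexPoint F J :=
  autPoint h (S.x₁Point S.one (S.wPoint p))

section

variable (S h)

lemma close_thetaPoint_p0 : S.Close p0 (thetaPoint S h p0) :=
  ⟨p0, ⟨l0, trivial, trivial⟩, l0, trivial, trivial⟩

lemma close_thetaPoint_p1 (t : F) : S.Close (p1 t) (thetaPoint S h (p1 t)) :=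
  ⟨p0, ⟨l0, trivial, trivial⟩, l1 _, trivial, rfl⟩

lemma close_thetaPoint_p2 (b : J) (u : F) : S.Close (p2 b u) (thetaPoint S h (p2 b u)) := by
  refine ⟨p0, ⟨l1 b, rfl, trivial⟩, ?_⟩
  simp only [thetaPoint, wPoint]
  split_ifs
  · exact ⟨l0, trivial, trivial⟩
  · exact ⟨l1 _, trivial, rfl⟩

end

section Theta

variable (hh : S.IsAut h) (hT : ∀ a : J, S.trace a • S.one = a + h a + h (h a))
  (hT' : ∀ a : J, S.trace (S.sharp a) = S.tr a (h a))

include hh hT'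

lemma isAut_one : h S.one = S.one := by
  have htr : S.trace (h S.one) = 3 := by
    rw [trace, S.tr_comm, ← hT', S.sharp_one, trace_one]
  have hnorm := S.norm_add_smul_one (h S.one) (-1)
  rw [← hh, S.sharp_one, S.isAut_norm hh, S.norm_one, htr] at hnorm
  have hzero := (S.norm_eq_zero_iff _).1 (hnorm.trans (by ring))
  rwa [neg_smul, one_smul, ← sub_eq_add_neg, sub_eq_zero] at hzero

lemma isAut_trace (a : J) : S.trace (h a) = S.trace a := by
  have htr := S.isAut_tr hh a S.one
  rwa [isAut_one hh hT'] at htr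

lemma tr_sharp_sharp_isAut (a : J) :
    S.tr (S.sharp a) (S.sharp (h a)) = S.norm a * S.trace a := by
  rw [← hh, ← hT', S.sharp_sharp, trace, trace, map_smul]
  rfl

lemma quartic_eq_zero_of_isAut (e : J) (s : F) :
    (⟨s, e, 0, h e, S.trace e + s, 0⟩ : UPlus S).quartic = 0 := by
  simp only [UPlus.quartic, tr_sharp_sharp_isAut hh hT', S.isAut_norm hh]
  ring

include hT in
lemma exists_thetaPoint_toPoint (g : UPlus S) : ∃ k : UPlus S, k.quartic = 0 ∧
    thetaPoint S h g.toPoint = (g * k).toPoint := by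
  obtain ⟨t, a, t', a', t'', c⟩ := g
  have hone := isAut_one hh hT'
  have htr := isAut_trace hh hT' a'
  have hsum := hT a'
  have hsharp := hT' a'
  have htrone := S.trace_one
  have hdrop : (⟨t, a, t', a', t'', c⟩ * UPlus.y₁ S (-c) : UPlus S) = ⟨t, a, t', a', t'', 0⟩ := by
    ext <;> simp [UPlus.mul_def, UPlus.y₁, S.sharp_zero]
  obtain ⟨e, he⟩ : ∃ e, e = h a' - t'' • S.one - a := ⟨_, rfl⟩
  refine ⟨UPlus.y₁ S (-c) * ⟨t'' - t, e, 0, h e, S.trace e + (t'' - t), 0⟩, ?_, ?_⟩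
  · rw [UPlus.quartic_y₁_mul, quartic_eq_zero_of_isAut hh hT']
  rw [← mul_assoc, hdrop, he]
  unfold trace at htr hsum hsharp htrone
  simp only [thetaPoint, wPoint, x₁Point, autPoint, UPlus.toPoint, UPlus.mul_def, S.norm_one,
    S.sharp_one, S.norm_zero, S.sharp_zero, map_sub, map_add, map_neg, map_smul, S.cross_one, hone,
    p5.injEq, trace, map_zero, LinearMap.zero_apply, LinearMap.sub_apply, LinearMap.smul_apply, htr,
    htrone, S.tr_comm S.one, hsharp, S.tr_comm a' a, smul_eq_mul, smul_zero, LinearMap.neg_apply]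
  refine ⟨by ring, by module, by ring, ?_, by ring⟩
  rw [hsum]
  module

include hT in
lemma close_thetaPoint_p5 (t : F) (a : J) (t' : F) (a' : J) (t'' : F) :
    S.Close (p5 t a t' a' t'') (thetaPoint S h (p5 t a t' a' t'')) := by
  obtain ⟨k, hk, hθ⟩ := exists_thetaPoint_toPoint hh hT hT' ⟨t, a, t', a', t'', 0⟩
  have hclose := UPlus.near_of_quartic_eq_zero hk ⟨t, a, t', a', t'', 0⟩
  rwa [← hθ] at hclose

lemma close_thetaPoint_p3 (t : F) (a : J) (t' : F) :
    S.Close (p3 t a t') (thetaPoint S h (p3 t a t')) := by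
  have htr := isAut_trace hh hT' a
  have hsharp := hT' a
  have htrone := S.trace_one
  unfold trace at htr hsharp htrone
  simp only [thetaPoint, wPoint, x₁Point, autPoint, zero_add, map_neg, isAut_one hh hT']
  refine ⟨p5 t a t' _ _, ⟨l4 t a t' _, ⟨rfl, rfl, rfl⟩, ⟨rfl, rfl, rfl, rfl⟩⟩,
    l5 S.one (-t) (-h a) t' (a + t • S.one), ⟨by module, ?_, rfl, rfl⟩, ⟨rfl, rfl, rfl, rfl⟩⟩
  simp only [S.norm_one, S.sharp_one, S.sharp_add, S.sharp_smul, map_add, map_neg, map_smul,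
    LinearMap.add_apply, LinearMap.neg_apply, LinearMap.smul_apply, smul_eq_mul, htr, hsharp,
    htrone, S.tr_comm (h a) a, S.cross_comm a, S.cross_one, LinearMap.sub_apply, map_sub]
  ring

lemma close_thetaPoint_p4_zero (u : F) (b' : J) (u' : F) :
    S.Close (p4 0 u b' u') (thetaPoint S h (p4 0 u b' u')) := by
  have hsharp := hT' b'
  unfold trace at hsharp
  simp only [thetaPoint, wPoint, if_true, x₁Point, autPoint, map_sub, map_smul, isAut_one hh hT']
  refine ⟨p5 u (h b' - u • S.one) _ b' u,
    ⟨l5 0 u b' u' (h b' - u • S.one), ⟨rfl, rfl, rfl, rfl⟩, ⟨by simp, ?_, ?_, ?_⟩⟩,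
    l4 u _ _ b', ⟨rfl, rfl, rfl, rfl⟩, ⟨rfl, rfl, rfl⟩⟩
  · simp only [S.norm_one, S.sharp_one, S.norm_zero, S.sharp_zero, map_zero, map_sub, map_smul,
      S.tr_comm S.one, hsharp, smul_eq_mul]
    ring
  · simp [S.sharp_zero]
  · simp [S.norm_zero, S.sharp_zero]

lemma norm_eq_neg_one_of_map_neg_inv_add_one {b : J} (hb : b ≠ 0)
    (hfix : h (-S.inv b + S.one) = b) : S.norm b = -1 := by
  have hn := S.norm_ne_zero hb
  have htrace : S.trace (-S.inv b) = S.trace b - 3 := by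
    conv_rhs => rw [← hfix, isAut_trace hh hT', trace, map_add, LinearMap.add_apply, ← trace,
      ← trace, trace_one]
    ring
  have hsharp : S.trace (S.sharp b) = S.norm b * (3 - S.trace b) := by
    rw [← neg_sub, ← htrace, S.sharp_eq hb]
    simp [trace]
  have hsharp_inv : S.trace (S.sharp (-S.inv b)) = (S.norm b)⁻¹ * S.trace b := by
    rw [S.sharp_neg, S.sharp_inv hb]
    simp [trace]
  have hfix' : h (-S.inv b + (1 : F) • S.one) = b := by rwa [one_smul]
  have hnorm : (S.norm b + 1) * (S.norm b + 1 - S.trace b) = 0 := by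
    have hN := S.norm_add_smul_one (-S.inv b) 1
    rw [← S.isAut_norm hh, hfix', S.norm_neg, S.norm_inv, hsharp_inv, htrace] at hN
    field_simp at hN
    linear_combination hN
  have htr : (S.norm b + 1) * ((S.norm b + 1) * S.trace b - 3 * S.norm b) = 0 := by
    have hT := S.trace_sharp_add_smul_one (-S.inv b) 1
    rw [← isAut_trace hh hT', hh, hfix', hsharp, hsharp_inv, htrace] at hT
    field_simp at hT
    linear_combination -hT
  by_contra hne
  have hne' : S.norm b + 1 ≠ 0 := fun h0 => hne (eq_neg_of_add_eq_zero_left h0)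
  have hT : S.trace b = S.norm b + 1 :=
    (sub_eq_zero.1 ((mul_eq_zero.1 hnorm).resolve_left hne')).symm
  have hcubic : S.norm b ^ 2 - S.norm b + 1 = 0 := by
    have hprod := (mul_eq_zero.1 htr).resolve_left hne'
    rw [hT] at hprod
    linear_combination hprod
  exact hne (S.norm_eq_neg_one_of_trace_eq hT hsharp hcubic)

include hT in
lemma close_thetaPoint_p4 {b : J} (hb : b ≠ 0) (u : F) (b' : J) (u' : F) :
    S.Close (p4 b u b' u') (thetaPoint S h (p4 b u b' u')) := by
  by_cases hfix : h (-S.inv b + S.one) = b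
  · simp only [thetaPoint, wPoint, hb, if_false, x₁Point, autPoint, hfix,
      norm_eq_neg_one_of_map_neg_inv_add_one hh hT' hb hfix]
    exact ⟨p2 b u, ⟨l3 b u b', ⟨rfl, rfl, rfl⟩, ⟨rfl, rfl⟩⟩,
      l3 b u _, ⟨rfl, rfl⟩, ⟨rfl, by ring, rfl⟩⟩
  have hθ := (S.ofAut h hh * S.x₁ S.one * S.w).2
  obtain ⟨v, hv⟩ : ∃ v, v = -((S.norm b)⁻¹ * u) := ⟨_, rfl⟩
  obtain ⟨c', hc'⟩ : ∃ c', c' = h (S.cross (S.inv b) b' -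
    ((S.norm b)⁻¹ * (u + S.tr b b')) • b) := ⟨_, rfl⟩
  obtain ⟨g, b'', v', c'', hg, hg'⟩ := S.exists_inc_l5_inc_l5 hfix u b' u' v c'
  obtain ⟨k, hk, hgk⟩ := exists_thetaPoint_toPoint hh hT hT' g
  have hθg := (hθ _ _).2 hg
  change S.Inc (thetaPoint S h g.toPoint)
    (autLine h (S.x₁Line S.one (S.wLine (l5 b u b' u' b'')))) at hθg
  simp only [hgk, wLine, hb, if_false, x₁Line, autLine, ← hv, ← hc'] at hθg
  have hsq := UPlus.quartic_inv_mul_of_inc hg' hθg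
  rw [inv_mul_cancel_left, hk] at hsq
  refine ⟨g.toPoint, ⟨l5 b u b' u' b'', ⟨rfl, rfl, rfl, rfl⟩, hg⟩, _, hg', ?_⟩
  simp only [thetaPoint, wPoint, hb, if_false, x₁Point, autPoint, ← hv, ← hc']
  exact ⟨rfl, rfl, rfl, sub_eq_zero.1 (sq_eq_zero_iff.1 hsq.symm)⟩

end Theta

end HexagonalSystem

theorem mainTheorem5 {F J : Type*} [Field F] [AddCommGroup J] [Module F J]
    (S : HexagonalSystem F J) (h : J ≃ₗ[F] J) (hh : S.IsAut h)
    (hord : orderOf h = 1 ∨ orderOf h = 3)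
    (hT : ∀ a : J, S.trace a • S.one = a + h a + h (h a))
    (hT' : ∀ a : J, S.trace (S.sharp a) = S.tr a (h a)) :
    S.PointDomestic (S.ofAut h hh * S.x₁ S.one * S.s₁ S.one) := by
  rw [S.s₁_one]
  intro p
  suffices hclose : S.Close p (S.thetaPoint h p) from hclose.not_opposite
  cases p with
  | p0 => exact S.close_thetaPoint_p0 h
  | p1 t => exact S.close_thetaPoint_p1 h t
  | p2 b u => exact S.close_thetaPoint_p2 h b u
  | p3 t a t' => exact HexagonalSystem.close_thetaPoint_p3 hh hT' t a t'
  | p4 b u b' u' =>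
    rcases eq_or_ne b 0 with rfl | hb
    · exact HexagonalSystem.close_thetaPoint_p4_zero hh hT' u b' u'
    · exact HexagonalSystem.close_thetaPoint_p4 hh hT hT' hb u b' u'
  | p5 t a t' a' t'' => exact HexagonalSystem.close_thetaPoint_p5 hh hT hT' t a t' a' t''
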